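/- Let $n\ge 2$ and let $V=\{x\in\mathbb R^n:\sum_i x_i=0\}$, with the standard scalar product $(\cdot,\cdot)$, root system $\Phi=A_{n-1}=\{e_p-e_q: p\ne q\}$, simple roots $\alpha_i=e_i-e_{i+1}$ ($1\le i\le n-1$) and Weyl group $W\cong S_n$. The *maximal building set* $\mathcal C=\mathcal C_{A_{n-1}}$ consists of all nonzero subspaces spanned by roots; $\mathcal C_{fund}$ consists of those spanned by simple roots. Let $\delta$ be half the sum of the positive roots; for $A\in\mathcal C_{fund}$ let $\pi_A$ be the orthogonal projection of $\delta$ to $A$, and put $\delta_A=\delta-\pi_A$ if $A\neq V$, $\delta_V=\delta$. For $B\subsetneq A$ in $\mathcal C_{fund}$ let $R^A_B$ be the largest coefficient of $\pi_A$ divided by the smallest coefficient of $\pi_B$, when these vectors are written in terms of the simple roots contained in $A$ and in $B$ respectively, and let $R^i_j$ be the maximum of $R^A_B$ over all such pairs with $\dim A=i$, $\dim B=j$. A list of positive numbers $\epsilon_1<\epsilon_2<\dots<\epsilon_{n-1}=a$ is *suitable* if $\epsilon_i>2R^i_{i-1}\epsilon_{i-1}$ for $i=2,\dots,n-1$. Given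 a suitable list, let $HS_V=\{x\in V:(x,\delta)\le a\}$ and $HS_A=\{x\in V:(x,\delta_A)\le a-\epsilon_{\dim A}\}$ for $A\in\mathcal C_{fund}$, $A\ne V$. The *maximal permutonestohedron of type $A_{n-1}$* is the polytope $$P_{\mathcal C_{A_{n-1}}}(A_{n-1})=\bigcap_{\sigma\in W}\ \bigcap_{A\in\mathcal C_{fund}}\sigma\,HS_A .$$ For a partition $\lambda=(\lambda_1,\dots,\lambda_{l(\lambda)})$ of $n$ in which the part $i$ appears $m_i$ times put $w(\lambda)=\dfrac{l(\lambda)!}{\prod_{1\le i\le n}m_i!}$. **Theorem.** For every $0\le k\le n-2$ and every suitable list, the number of faces of codimension $k+1$ of the maximal permutonestohedron $P_{\mathcal C_{A_{n-1}}}(A_{n-1})$ is $$\sum_{\substack{\lambda\vdash n\\ l(\lambda)\ge k+2}} w(\lambda)\,\frac{n!}{\lambda_1!\lambda_2!\cdots\lambda_{l(\lambda)}!}\left[\ \sum_{1<j_1<\cdots<j_k<j_{k+1}=l(\lambda)}\ \prod_{t=1}^{k}\binom{j_{t+1}-1}{j_t-1}\right],$$ where for $k=0$ the bracket equals $1$.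 -/

import Mathlib

namespace Permutonestohedron

noncomputable section

section General

/- `V` is a Euclidean space, `Φ` a finite set of roots in `V`, and `Δ` the basis of simple roots. -/
variable {V : Type*} [NormedAddCommGroup V] [InnerProductSpace ℝ V] [FiniteDimensional ℝ V]
variable {ι : Type*}

/-- The group generated by the orthogonal reflections in the hyperplanes `βᗮ`, `β ∈ Φ`. -/
def weylGroup (Φ : Finset V) : Subgroup (V ≃ₗᵢ[ℝ] V) :=
  Subgroup.closure {s | ∃ β ∈ Φ, s = (ℝ ∙ β)ᗮ.reflection}

/-- The maximal building set associated to `Φ`: all the subspaces that are spanned by a nonempty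
set of roots. -/
def maximalBuildingSet (Φ : Finset V) : Set (Submodule ℝ V) :=
  {A | ∃ S : Set V, S ⊆ (Φ : Set V) ∧ S.Nonempty ∧ A = Submodule.span ℝ S}

/-- The members of `G` that are spanned by some of the simple roots. -/
def fund (Δ : Module.Basis ι ℝ V) (G : Set (Submodule ℝ V)) : Set (Submodule ℝ V) :=
  {A | A ∈ G ∧ ∃ I : Set ι, A = Submodule.span ℝ (Δ '' I)}

open Classical in
/-- The positive roots: the roots that are nonnegative combinations of the simple roots. -/
def positiveRoots (Φ : Finset V) (Δ : Module.Basis ι ℝ V) : Finset V :=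
  {β ∈ Φ | ∀ i, 0 ≤ Δ.repr β i}

/-- Half the sum of the positive roots. -/
def delta (Φ : Finset V) (Δ : Module.Basis ι ℝ V) : V :=
  (1 / 2 : ℝ) • ∑ β ∈ positiveRoots Φ Δ, β

/-- `π_A`, the orthogonal projection of `δ` to `A` (so that `π_V = δ`). -/
def piVec (Φ : Finset V) (Δ : Module.Basis ι ℝ V) (A : Submodule ℝ V) : V :=
  A.starProjection (delta Φ Δ)

open Classical in
/-- `δ_A = δ - π_A` (the orthogonal projection of `δ` to `Aᗮ`) for `A ≠ V`, and `δ_V = δ`. -/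
def deltaVec (Φ : Finset V) (Δ : Module.Basis ι ℝ V) (A : Submodule ℝ V) : V :=
  if A = ⊤ then delta Φ Δ else delta Φ Δ - piVec Φ Δ A

/-- `R^A_B`: the maximum coefficient of `π_A` divided by the minimum coefficient of `π_B`, where
`π_A` and `π_B` are written in terms of the simple roots contained in `A` and in `B`. -/
def ratio (Φ : Finset V) (Δ : Module.Basis ι ℝ V) (A B : Submodule ℝ V) : ℝ :=
  (⨆ i : {i : ι // Δ i ∈ A}, Δ.repr (piVec Φ Δ A) i) /
    (⨅ i : {i : ι // Δ i ∈ B}, Δ.repr (piVec Φ Δ B) i)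

/-- `R^i_j`: the maximum of `R^A_B` over the finitely many pairs `B ⊂ A` in `G_fund` with
`dim A = i` and `dim B = j`. -/
def maxRatio (Φ : Finset V) (Δ : Module.Basis ι ℝ V) (G : Set (Submodule ℝ V)) (i j : ℕ) : ℝ :=
  sSup {r | ∃ A ∈ fund Δ G, ∃ B ∈ fund Δ G, B < A ∧
    Module.finrank ℝ A = i ∧ Module.finrank ℝ B = j ∧ r = ratio Φ Δ A B}

/-- Suitable lists `ε_1 < ε_2 < ⋯ < ε_d = a` of positive numbers, where `d = dim V`: only the
values `ε 1, …, ε d` of the function `ε` matter, and the number `a` is `ε d`. -/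
structure IsSuitableList (Φ : Finset V) (Δ : Module.Basis ι ℝ V) (G : Set (Submodule ℝ V))
    (ε : ℕ → ℝ) : Prop where
  pos : ∀ i, 1 ≤ i → i ≤ Module.finrank ℝ V → 0 < ε i
  lt : ∀ i, 2 ≤ i → i ≤ Module.finrank ℝ V → ε (i - 1) < ε i
  gap : ∀ i, 2 ≤ i → i ≤ Module.finrank ℝ V → 2 * maxRatio Φ Δ G i (i - 1) * ε (i - 1) < ε i

open Classical in
/-- The closed half-space `HS_A` for `A` in `G_fund`. Its boundary is the hyperplane
`(x, δ_A) = a - ε_{dim A}` if `A ≠ V`, and `(x, δ) = a` if `A = V`; it contains the origin because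
these right hand sides are positive for suitable lists. -/
def halfSpace (Φ : Finset V) (Δ : Module.Basis ι ℝ V) (ε : ℕ → ℝ) (A : Submodule ℝ V) : Set V :=
  {x | inner ℝ x (deltaVec Φ Δ A) ≤
    if A = ⊤ then ε (Module.finrank ℝ V)
    else ε (Module.finrank ℝ V) - ε (Module.finrank ℝ A)}

/-- The summands of the `G_fund`-decomposition of `B`: the maximal elements of `G_fund` that are
contained in `B`. -/
def decomposition (Δ : Module.Basis ι ℝ V) (G : Set (Submodule ℝ V)) (B : Submodule ℝ V) :
    Set (Submodule ℝ V) :=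
  {A | Maximal (fun C => C ∈ fund Δ G ∧ C ≤ B) A}

/-- The closed half-space for `B` spanned by simple roots and not in `G_fund`, with decomposition
`B = A_1 ⊕ ⋯ ⊕ A_r`: it is given by
`(x, δ - π_{A_1} - ⋯ - π_{A_r}) ≤ a - ε_{dim A_1} - ⋯ - ε_{dim A_r}`. -/
def halfSpaceBar (Φ : Finset V) (Δ : Module.Basis ι ℝ V) (G : Set (Submodule ℝ V)) (ε : ℕ → ℝ)
    (B : Submodule ℝ V) : Set V :=
  {x | inner ℝ x (delta Φ Δ - ∑ᶠ A ∈ decomposition Δ G B, piVec Φ Δ A) ≤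
    ε (Module.finrank ℝ V) - ∑ᶠ A ∈ decomposition Δ G B, ε (Module.finrank ℝ A)}

/-- The permutonestohedron `P_G(Φ)` determined by the list `ε`: the intersection of the images,
under all elements of the group `W` of `Φ`, of the half-spaces of all `A` in `G_fund` and of all
`B` that are spanned by simple roots and are not in `G_fund`. -/
def permutonestohedron (Φ : Finset V) (Δ : Module.Basis ι ℝ V) (G : Set (Submodule ℝ V))
    (ε : ℕ → ℝ) : Set V :=
  (⋂ σ ∈ weylGroup Φ, ⋂ A ∈ fund Δ G, σ '' halfSpace Φ Δ ε A) ∩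
    ⋂ σ ∈ weylGroup Φ, ⋂ B ∈ fund Δ (maximalBuildingSet Φ) \ fund Δ G,
      σ '' halfSpaceBar Φ Δ G ε B

/-- The (nonempty) faces of codimension `c` of the polytope `P`: the sets of maximum points in `P`
of linear forms, with `dim F + c = dim P`. -/
def facesOfCodim (P : Set V) (c : ℕ) : Set (Set V) :=
  {F | F.Nonempty ∧ IsExposed ℝ P F ∧
    Module.finrank ℝ (vectorSpan ℝ F) + c = Module.finrank ℝ (vectorSpan ℝ P)}

end General

section TypeA

/-- The Euclidean space of the root system `A_{n-1}`: the vectors in `ℝⁿ` with zero sum. -/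
abbrev TypeASpace (n : ℕ) : Submodule ℝ (EuclideanSpace ℝ (Fin n)) where
  carrier := {x | ∑ i, x i = 0}
  add_mem' := by
    intro x y hx hy
    simp only [Set.mem_ofPred_eq, PiLp.add_apply, Finset.sum_add_distrib] at *
    rw [hx, hy, add_zero]
  zero_mem' := by simp
  smul_mem' := by
    intro c x hx
    simp only [Set.mem_ofPred_eq, PiLp.smul_apply, smul_eq_mul, ← Finset.mul_sum] at *
    rw [hx, mul_zero]

/-- The vector `e_p - e_q`. -/
def typeARoot {n : ℕ} (p q : Fin n) : TypeASpace n :=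
  ⟨EuclideanSpace.single p 1 - EuclideanSpace.single q 1, by
    simp [PiLp.sub_apply, Finset.sum_sub_distrib]⟩

open Classical in
/-- The root system `A_{n-1}`: all the vectors `e_p - e_q` with `p ≠ q`. -/
def typeARoots (n : ℕ) : Finset (TypeASpace n) :=
  (Finset.univ : Finset (Fin n)).offDiag.image fun p => typeARoot p.1 p.2

/-- The simple root `e_i - e_{i+1}`. -/
def typeASimpleRoot (n : ℕ) (i : Fin (n - 1)) : TypeASpace n :=
  typeARoot ⟨i, by omega⟩ ⟨i + 1, by omega⟩

/-- The simple roots are linearly independent: the partial sums of coordinates are dual to them. -/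
theorem typeASimpleRoot_linearIndependent (n : ℕ) :
    LinearIndependent ℝ (typeASimpleRoot n) := by
  let f : TypeASpace n →ₗ[ℝ] (Fin (n - 1) → ℝ) :=
    { toFun := fun x i => ∑ j : Fin n, if (j : ℕ) ≤ i then x.1 j else 0
      map_add' := by
        intro x y
        funext i
        simp only [Pi.add_apply, ← Finset.sum_add_distrib]
        refine Finset.sum_congr rfl fun j _ => ?_
        split_ifs <;> simp
      map_smul' := by
        intro c x
        funext i
        simp only [Pi.smul_apply, smul_eq_mul, Finset.mul_sum, RingHom.id_apply]
        refine Finset.sum_congr rfl fun j _ => ?_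
        split_ifs <;> simp }
  have hf : ∀ i, f (typeASimpleRoot n i) = Pi.single i 1 := by
    intro i
    funext i'
    have h1 : ∀ (m : Fin n), (∑ j : Fin n, if (j : ℕ) ≤ (i' : ℕ) then
        (EuclideanSpace.single m (1 : ℝ)) j else 0) =
          if (m : ℕ) ≤ (i' : ℕ) then (1 : ℝ) else 0 := by
      intro m
      rw [Finset.sum_eq_single m]
      · simp
      · intro b _ hb
        simp [hb]
      · simp
    have h2 : f (typeASimpleRoot n i) i' =
        (if (i : ℕ) ≤ (i' : ℕ) then (1 : ℝ) else 0) -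
          (if (i : ℕ) + 1 ≤ (i' : ℕ) then (1 : ℝ) else 0) := by
      have e1 := h1 ⟨i, by omega⟩
      have e2 := h1 ⟨i + 1, by omega⟩
      simp only at e1 e2
      rw [← e1, ← e2]
      change (∑ j : Fin n, if (j : ℕ) ≤ (i' : ℕ) then (typeASimpleRoot n i).1 j else 0) = _
      refine Eq.trans ?_ (Finset.sum_sub_distrib _ _)
      refine Finset.sum_congr rfl fun j _ => ?_
      by_cases h : (j : ℕ) ≤ i' <;> simp [h, typeASimpleRoot, typeARoot]
    rw [h2]
    by_cases h : i = i'
    · subst h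
      simp
    · have h' : (i : ℕ) ≠ i' := fun hh => h (Fin.ext hh)
      have h2' : ¬ i' = i := fun hh => h hh.symm
      rw [Pi.single_apply, if_neg h2']
      by_cases h3 : (i : ℕ) ≤ (i' : ℕ)
      · have h4 : (i : ℕ) + 1 ≤ (i' : ℕ) := by omega
        rw [if_pos h3, if_pos h4, sub_self]
      · have h4 : ¬ (i : ℕ) + 1 ≤ (i' : ℕ) := by omega
        rw [if_neg h3, if_neg h4, sub_self]
  apply LinearIndependent.of_comp f
  have : (f ∘ typeASimpleRoot n) = fun i => Pi.single i (1 : ℝ) := funext hf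
  rw [this]
  exact Pi.linearIndependent_single_one _ ℝ

/-- The simple roots span the space. -/
theorem typeASimpleRoot_span (n : ℕ) :
    ⊤ ≤ Submodule.span ℝ (Set.range (typeASimpleRoot n)) := by
  rintro x -
  rcases Nat.eq_zero_or_pos n with rfl | hn
  · have : x = 0 := Subtype.ext (by ext i; exact i.elim0)
    rw [this]
    exact Submodule.zero_mem _
  have key : ∀ m (hm : m < n), typeARoot ⟨m, hm⟩ ⟨0, hn⟩ ∈
      Submodule.span ℝ (Set.range (typeASimpleRoot n)) := by
    intro m
    induction m with
    | zero =>
      intro _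
      have : typeARoot ⟨0, hn⟩ ⟨0, hn⟩ = (0 : TypeASpace n) :=
        Subtype.ext (by simp [typeARoot])
      rw [this]
      exact Submodule.zero_mem _
    | succ m ih =>
      intro hm
      have : typeARoot ⟨m + 1, hm⟩ ⟨0, hn⟩ =
          typeARoot ⟨m, by omega⟩ ⟨0, hn⟩ - typeASimpleRoot n ⟨m, by omega⟩ :=
        Subtype.ext (by simp [typeARoot, typeASimpleRoot])
      rw [this]
      exact Submodule.sub_mem _ (ih _) (Submodule.subset_span ⟨_, rfl⟩)
  have hx : x = ∑ p : Fin n, x.1 p • typeARoot p ⟨0, hn⟩ := by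
    apply Subtype.ext
    ext j
    have h0 : ∑ p, x.1 p = 0 := x.2
    simp [typeARoot, mul_sub, Finset.sum_sub_distrib, h0, Pi.single_apply]
  rw [hx]
  exact Submodule.sum_mem _ fun p _ => Submodule.smul_mem _ _ (key p p.2)

/-- The basis of simple roots `e_1 - e_2, …, e_{n-1} - e_n` of the root system `A_{n-1}`. -/
def typeASimpleRoots (n : ℕ) : Module.Basis (Fin (n - 1)) ℝ (TypeASpace n) :=
  Module.Basis.mk (typeASimpleRoot_linearIndependent n) (typeASimpleRoot_span n)

end TypeA

section Counting

/-- `w(λ) = l(λ)! / ∏ m_i!`, where `m_i` is the number of parts of `λ` that are equal to `i`. -/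
def partitionWeight {n : ℕ} (p : n.Partition) : ℚ :=
  (p.parts.card.factorial : ℚ) / ∏ i ∈ Finset.Icc 1 n, ((p.parts.count i).factorial : ℚ)

/-- `n! / (λ_1! λ_2! ⋯ λ_l!)`. -/
def partitionMultinomial {n : ℕ} (p : n.Partition) : ℚ :=
  (n.factorial : ℚ) / (p.parts.map fun m => (m.factorial : ℚ)).prod

/-- The sum over all `1 < j_1 < ⋯ < j_k < j_{k+1} = l` of the products of the binomials
`(j_{t+1} - 1).choose (j_t - 1)`, `1 ≤ t ≤ k`. -/
def chainSum (k l : ℕ) : ℕ :=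
  ∑ j ∈ (Finset.univ : Finset (Fin (k + 1) → Fin (l + 1))).filter
      (fun j : Fin (k + 1) → Fin (l + 1) =>
        StrictMono j ∧ (∀ t, 1 < (j t : ℕ)) ∧ (j (Fin.last k) : ℕ) = l),
    ∏ t : Fin k, ((j t.succ : ℕ) - 1).choose ((j t.castSucc : ℕ) - 1)

end Counting

end

end Permutonestohedron

namespace Permutonestohedron

noncomputable section

open Module Submodule

open scoped InnerProductSpace

set_option linter.unusedSectionVars false

/-! ### Faces of a polyhedron whose normals carry a complete simplicial fan. -/

section Polytope

variable {V : Type*} [NormedAddCommGroup V] [InnerProductSpace ℝ V]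

/-! The polytope is simple, and its normal fan is an explicit complete simplicial fan. Encode the
span of the simple roots indexed by `I` by `D = Iᶜ`, except that `V` itself is encoded by the full
set. Then `δ_A` becomes a vector `n_D` (`facetNormal`) that pairs positively with the simple roots
in `D` and to zero with the others. Cones over the flags of nonempty sets `D` subdivide the dominant
chamber, as in a barycentric subdivision, and their images under the Weyl group cover the space.

By `ncard_facesOfCodim_polyhedron`, faces of codimension `c` correspond to cones with `c` generators
as soon as each cone has a point at which exactly its own inequalities are equalities. Suitability
of `ε` provides such points. When `(x, δ) = a`, the inequality for `I` says `(x, π_I) ≥ ε_{|I|}`,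
and the factor 2 in the gaps allows the coordinates of `x` to be chosen one after the other
(`IsGapped.exists_weights`); a perturbation of `ε` removes the unwanted equalities
(`exists_tight_point`). Normals outside the chamber cause no trouble because `(v, σ u) < (v, u)` for
regular dominant `v` and dominant `u` with `σ u ≠ u`, which in type A is the rearrangement
inequality (`hasChamber_typeA`).

It remains to count images of flags. What fixes the normal of the top set `D` fixes those of its
subsets, so each flag has as many images as `n_D` (`ncard_facesOfCodim_eq_sum`). The flags below `D`
are counted by the bracket with `l = |D| + 1` and `j_t = |D_t| + 1` (`card_flagsWithTop`). Finally
`D` is the set of bars of a composition of `n` with `|D| + 1` blocks, and the coordinates of `n_D`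
agree exactly within blocks: the orbit has `n!/∏ λ_i!` elements, and `w(λ)` compositions rearrange
to `λ`. -/

/-- The polyhedron `(x, u) ≤ b u`, `u ∈ N`. -/
def polyhedron (N : Set V) (b : V → ℝ) : Set V := {x | ∀ u ∈ N, inner ℝ x u ≤ b u}

/-- The part of the polyhedron where the inequalities of `S` are equalities. -/
def tightFace (N : Set V) (b : V → ℝ) (S : Finset V) : Set V :=
  {x | x ∈ polyhedron N b ∧ ∀ u ∈ S, inner ℝ x u = b u}

/-- `v` satisfies the inequalities of `S` with equality and the other ones strictly. -/
def IsTightAt (N : Set V) (b : V → ℝ) (S : Finset V) (v : V) : Prop :=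
  (∀ u ∈ S, inner ℝ v u = b u) ∧ ∀ u ∈ N, u ∉ S → inner ℝ v u < b u

theorem IsTightAt.mem_tightFace {N : Set V} {b : V → ℝ} {S : Finset V} {v : V}
    (h : IsTightAt N b S v) : v ∈ tightFace N b S := by
  refine ⟨fun u hu => ?_, h.1⟩
  by_cases hS : u ∈ S
  · exact (h.1 u hS).le
  · exact (h.2 u hu hS).le

theorem tightFace_subset_imp {N : Set V} {b : V → ℝ} {S T : Finset V} {v : V} (hT : ↑T ⊆ N)
    (h : IsTightAt N b S v) (hST : tightFace N b S ⊆ tightFace N b T) : T ⊆ S := by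
  intro u hu
  by_contra hS
  exact absurd ((hST h.mem_tightFace).2 u hu) (h.2 u (hT hu) hS).ne

/-- The inequalities outside `S` are finitely many and strict at `v`, so they survive a small step
in any direction orthogonal to `S`. -/
theorem vectorSpan_tightFace {N : Set V} (hN : N.Finite) {b : V → ℝ} {S : Finset V} {v : V}
    (h : IsTightAt N b S v) : vectorSpan ℝ (tightFace N b S) = (span ℝ (S : Set V))ᗮ := by
  apply le_antisymm
  · rw [vectorSpan_def, span_le]
    rintro _ ⟨x, hx, y, hy, rfl⟩
    rw [SetLike.mem_coe, mem_orthogonal]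
    intro u hu
    rw [real_inner_comm]
    induction hu using span_induction with
    | mem u hu => simp [inner_sub_left, hx.2 u hu, hy.2 u hu]
    | zero => simp
    | add u w _ _ h1 h2 => rw [inner_add_right, h1, h2, add_zero]
    | smul c u _ h1 => rw [inner_smul_right, h1, mul_zero]
  · intro w hw
    have hw' : ∀ u ∈ S, inner ℝ w u = (0 : ℝ) := fun u hu =>
      (mem_orthogonal' _ _).1 hw u (subset_span hu)
    have hev : ∀ᶠ t : ℝ in nhds 0, ∀ u ∈ N, u ∉ S → inner ℝ (v + t • w) u < b u := by
      rw [Filter.eventually_all_finite hN]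
      intro u hu
      by_cases hS : u ∈ S
      · simp [hS]
      · have hc : ContinuousAt (fun t : ℝ => inner ℝ (v + t • w) u) 0 := by fun_prop
        have := hc.eventually_lt_const (u := b u) (by simpa using h.2 u hu hS)
        filter_upwards [this] with t ht _ using ht
    obtain ⟨t, ht, ht0⟩ := ((hev.filter_mono nhdsWithin_le_nhds).and
      (self_mem_nhdsWithin (s := {(0 : ℝ)}ᶜ))).exists
    have hmem : v + t • w ∈ tightFace N b S :=
      IsTightAt.mem_tightFace ⟨fun u hu => by
        simp [inner_add_left, inner_smul_left, hw' u hu, h.1 u hu], ht⟩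
    have hd := vsub_mem_vectorSpan ℝ hmem h.mem_tightFace
    simp only [vsub_eq_sub, add_sub_cancel_left] at hd
    simpa [smul_smul, inv_mul_cancel₀ (show t ≠ 0 from ht0)] using smul_mem _ t⁻¹ hd

/-- The form is at most `∑ w u * b u` on the polyhedron, and `v` attains this value; since all
weights are positive, attaining it forces equality in every term. -/
theorem setOf_isMax_eq_tightFace {N : Set V} {b : V → ℝ} {S : Finset V} {v : V} (hS : ↑S ⊆ N)
    (h : IsTightAt N b S v) {w : V → ℝ} (hw : ∀ u ∈ S, 0 < w u) :
    {x ∈ polyhedron N b | ∀ y ∈ polyhedron N b,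
      inner ℝ (∑ u ∈ S, w u • u) y ≤ inner ℝ (∑ u ∈ S, w u • u) x} = tightFace N b S := by
  have hin : ∀ x, inner ℝ (∑ u ∈ S, w u • u) x = ∑ u ∈ S, w u * inner ℝ x u := fun x => by
    rw [real_inner_comm, inner_sum]
    exact Finset.sum_congr rfl fun u _ => inner_smul_right _ _ _
  have hle : ∀ x ∈ polyhedron N b, ∀ u ∈ S, w u * inner ℝ x u ≤ w u * b u := fun x hx u hu =>
    mul_le_mul_of_nonneg_left (hx u (hS hu)) (hw u hu).le
  ext x
  constructor
  · rintro ⟨hx, hmax⟩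
    refine ⟨hx, ?_⟩
    have h1 := hmax v h.mem_tightFace.1
    rw [hin, hin, Finset.sum_congr rfl fun u hu => by rw [h.1 u hu]] at h1
    have h2 := (Finset.sum_eq_sum_iff_of_le (hle x hx)).1
      (le_antisymm (Finset.sum_le_sum (hle x hx)) h1)
    exact fun u hu => mul_left_cancel₀ (hw u hu).ne' (h2 u hu)
  · rintro ⟨hx, hxS⟩
    refine ⟨hx, fun y hy => ?_⟩
    rw [hin, hin]
    exact Finset.sum_le_sum fun u hu => (hle y hy u hu).trans_eq (by rw [hxS u hu])

/-- Each linear form lies in the relative interior of some cone of `K`, so its maxima form a tight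
face; independence gives the codimension, and the tight points show that different cones give
different faces. -/
theorem ncard_facesOfCodim_polyhedron [FiniteDimensional ℝ V] {N : Set V} (hN : N.Finite)
    (b : V → ℝ) (K : Set (Finset V)) (hK : ∀ S ∈ K, ↑S ⊆ N)
    (hLI : ∀ S ∈ K, LinearIndepOn ℝ id (S : Set V))
    (hempty : ∅ ∈ K)
    (hcover : ∀ y : V, ∃ S ∈ K, ∃ w : V → ℝ, (∀ u ∈ S, 0 < w u) ∧ y = ∑ u ∈ S, w u • u)
    (htight : ∀ S ∈ K, ∃ v, IsTightAt N b S v) (c : ℕ) :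
    (facesOfCodim (polyhedron N b) c).ncard = {S ∈ K | S.card = c}.ncard := by
  have hdim : ∀ S ∈ K, finrank ℝ (vectorSpan ℝ (tightFace N b S)) + S.card = finrank ℝ V := by
    intro S hS
    obtain ⟨v, hv⟩ := htight S hS
    rw [vectorSpan_tightFace hN hv, ← finrank_add_finrank_orthogonal (span ℝ (S : Set V)), add_comm]
    congr 1
    have := finrank_span_set_eq_card (hLI S hS)
    rw [this]; simp
  -- The empty cone yields the polyhedron itself, which therefore has full dimension.
  have hP : tightFace N b ∅ = polyhedron N b := by ext; simp [tightFace]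
  have hdimP : finrank ℝ (vectorSpan ℝ (polyhedron N b)) = finrank ℝ V := by
    rw [← hP]; simpa using hdim ∅ hempty
  have himg : facesOfCodim (polyhedron N b) c = tightFace N b '' {S ∈ K | S.card = c} := by
    ext F
    constructor
    · rintro ⟨hne, hexp, hFdim⟩
      obtain ⟨l, hl⟩ := hexp hne
      obtain ⟨S, hS, w, hw, hy⟩ := hcover ((InnerProductSpace.toDual ℝ V).symm l)
      obtain ⟨v, hv⟩ := htight S hS
      have hF : F = tightFace N b S := by
        rw [hl, ← setOf_isMax_eq_tightFace (hK S hS) hv hw, ← hy]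
        simp
      refine ⟨S, ⟨hS, ?_⟩, hF.symm⟩
      have := hdim S hS
      rw [hF] at hFdim
      omega
    · rintro ⟨S, ⟨hS, hc⟩, rfl⟩
      obtain ⟨v, hv⟩ := htight S hS
      refine ⟨⟨v, hv.mem_tightFace⟩, fun _ => ?_, ?_⟩
      · refine ⟨InnerProductSpace.toDual ℝ V (∑ u ∈ S, (1 : ℝ) • u), ?_⟩
        rw [← setOf_isMax_eq_tightFace (hK S hS) hv (w := fun _ => 1) (by simp)]
        rfl
      · rw [hdimP, ← hdim S hS, hc]
  rw [himg, Set.InjOn.ncard_image]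
  rintro S ⟨hS, -⟩ T ⟨hT, -⟩ hST
  obtain ⟨v, hv⟩ := htight S hS
  obtain ⟨v', hv'⟩ := htight T hT
  exact (tightFace_subset_imp (hK S hS) hv' hST.ge).antisymm
    (tightFace_subset_imp (hK T hT) hv hST.le)

end Polytope

/-! ### Obtuse bases and the projections of `δ`. -/

section RootBasis

variable {V : Type*} [NormedAddCommGroup V] [InnerProductSpace ℝ V] [FiniteDimensional ℝ V]
variable {ι : Type*} [Fintype ι] [DecidableEq ι]

/-- The span of the simple roots with index in `I`. -/
def simpleSpan (Δ : Basis ι ℝ V) (I : Finset ι) : Submodule ℝ V := span ℝ (Δ '' (I : Set ι))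

/-- The projection of `δ` to the span of the simple roots with index in `I`. -/
def rhoPart (Δ : Basis ι ℝ V) (δ : V) (I : Finset ι) : V := (simpleSpan Δ I).starProjection δ

/-- The facet normal that is orthogonal to the simple roots with index outside `D`. -/
def facetNormal (Δ : Basis ι ℝ V) (δ : V) (D : Finset ι) : V := δ - rhoPart Δ δ Dᶜ

/-- An obtuse basis and a vector with scalar products `1` with the elements of the basis. -/
structure IsObtuse (Δ : Basis ι ℝ V) (δ : V) : Prop where
  inner_nonpos : ∀ i j, i ≠ j → inner ℝ (Δ i) (Δ j) ≤ 0
  inner_delta : ∀ i, inner ℝ δ (Δ i) = 1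

/-- Split `p = r + q` into its positive and negative parts. Obtuseness gives `(r, q) ≥ 0`, the
hypothesis gives `(p, q) ≤ 0`, so `(q, q) ≤ 0` and `q = 0`. -/
theorem repr_nonneg_of_inner_nonneg {Δ : Basis ι ℝ V} {δ : V} (h : IsObtuse Δ δ) {p : V}
    (hp : ∀ i, Δ.repr p i ≠ 0 → 0 ≤ inner ℝ p (Δ i)) (i : ι) : 0 ≤ Δ.repr p i := by
  set c := Δ.repr p with hc
  set r := ∑ i, max (c i) 0 • Δ i with hr
  set q := ∑ i, min (c i) 0 • Δ i with hq
  have hpq : p = r + q := by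
    rw [hr, hq, ← Finset.sum_add_distrib]
    simp only [← add_smul, max_add_min, add_zero]
    exact (Δ.sum_repr p).symm
  have hrq : 0 ≤ inner ℝ r q := by
    rw [hr, hq, sum_inner]
    simp only [inner_sum, inner_smul_left, inner_smul_right]
    refine Finset.sum_nonneg fun i _ => Finset.sum_nonneg fun j _ => ?_
    by_cases hij : i = j
    · subst hij
      rcases le_total (c i) 0 with h0 | h0 <;> simp [h0]
    · have h1 := h.inner_nonpos i j hij
      have h2 : 0 ≤ max (c i) 0 := le_max_right _ _
      have h3 : min (c j) 0 ≤ 0 := min_le_right _ _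
      have := mul_nonneg h2 (mul_nonneg_of_nonpos_of_nonpos h3 h1)
      simp only [conj_trivial]
      linarith
  have hpq' : inner ℝ p q ≤ 0 := by
    rw [hq, inner_sum]
    refine Finset.sum_nonpos fun j _ => ?_
    rw [inner_smul_right]
    by_cases hj : c j = 0
    · simp [hj]
    · exact mul_nonpos_of_nonpos_of_nonneg (min_le_right _ _) (hp j hj)
  have hqq : inner ℝ q q ≤ 0 := by
    rw [hpq, inner_add_left] at hpq'
    linarith
  have hq0 : q = 0 := by
    rw [real_inner_self_eq_norm_sq] at hqq
    exact norm_eq_zero.1 (pow_eq_zero_iff two_ne_zero |>.1 (hqq.antisymm (sq_nonneg _)))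
  have := (Fintype.linearIndependent_iff.1 Δ.linearIndependent) _ (hq.symm.trans hq0) i
  exact min_eq_right_iff.1 this

theorem repr_rhoPart_eq_zero (Δ : Basis ι ℝ V) (δ : V) {I : Finset ι} {i : ι} (hi : i ∉ I) :
    Δ.repr (rhoPart Δ δ I) i = 0 := by
  have h : rhoPart Δ δ I ∈ span ℝ (Δ '' (I : Set ι)) := starProjection_apply_mem _ _
  rw [Basis.mem_span_image] at h
  by_contra h0
  exact hi (h (Finsupp.mem_support_iff.2 h0))

theorem rhoPart_empty (Δ : Basis ι ℝ V) (δ : V) : rhoPart Δ δ ∅ = 0 := by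
  simp [rhoPart, simpleSpan]

theorem rhoPart_univ (Δ : Basis ι ℝ V) (δ : V) : rhoPart Δ δ Finset.univ = δ := by
  have : simpleSpan Δ Finset.univ = ⊤ := by simp [simpleSpan, Δ.span_eq]
  exact starProjection_eq_self_iff.2 (this ▸ mem_top)

theorem inner_rhoPart {Δ : Basis ι ℝ V} {δ : V} (h : IsObtuse Δ δ) {I : Finset ι} {i : ι}
    (hi : i ∈ I) : inner ℝ (rhoPart Δ δ I) (Δ i) = 1 := by
  have h1 : δ - rhoPart Δ δ I ∈ (simpleSpan Δ I)ᗮ := sub_starProjection_mem_orthogonal _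
  have h2 := (mem_orthogonal' _ _).1 h1 (Δ i) (subset_span ⟨i, hi, rfl⟩)
  rw [inner_sub_left, h.inner_delta] at h2
  linarith

theorem repr_rhoPart_nonneg {Δ : Basis ι ℝ V} {δ : V} (h : IsObtuse Δ δ) (I : Finset ι) (i : ι) :
    0 ≤ Δ.repr (rhoPart Δ δ I) i := by
  refine repr_nonneg_of_inner_nonneg h (fun j hj => ?_) i
  rw [inner_rhoPart h (by_contra fun hI => hj (repr_rhoPart_eq_zero Δ δ hI))]
  exact zero_le_one

theorem inner_eq_sum_repr (Δ : Basis ι ℝ V) (p x : V) :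
    inner ℝ p x = ∑ i, Δ.repr p i * inner ℝ (Δ i) x := by
  conv_lhs => rw [← Δ.sum_repr p, sum_inner]
  exact Finset.sum_congr rfl fun i _ => by rw [inner_smul_left]; rfl

theorem inner_rhoPart_nonpos {Δ : Basis ι ℝ V} {δ : V} (h : IsObtuse Δ δ) {I : Finset ι} {i : ι}
    (hi : Δ.repr (rhoPart Δ δ I) i = 0) : inner ℝ (rhoPart Δ δ I) (Δ i) ≤ 0 := by
  rw [inner_eq_sum_repr Δ]
  refine Finset.sum_nonpos fun j _ => ?_
  by_cases hij : j = i
  · rw [hij, hi, zero_mul]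
  · exact mul_nonpos_of_nonneg_of_nonpos (repr_rhoPart_nonneg h I j) (h.inner_nonpos j i hij)

/-- If the coefficient at `i` vanished, the other ones, being nonnegative, would make the product
with `Δ i` nonpositive; but it is 1. -/
theorem repr_rhoPart_pos {Δ : Basis ι ℝ V} {δ : V} (h : IsObtuse Δ δ) {I : Finset ι} {i : ι}
    (hi : i ∈ I) : 0 < Δ.repr (rhoPart Δ δ I) i := by
  refine (repr_rhoPart_nonneg h I i).lt_of_ne fun h0 => ?_
  have := inner_rhoPart_nonpos h h0.symm
  rw [inner_rhoPart h hi] at this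
  linarith

theorem inner_facetNormal_eq_zero {Δ : Basis ι ℝ V} {δ : V} (h : IsObtuse Δ δ) {D : Finset ι}
    {i : ι} (hi : i ∉ D) : inner ℝ (facetNormal Δ δ D) (Δ i) = 0 := by
  rw [facetNormal, inner_sub_left, h.inner_delta, inner_rhoPart h (by simpa using hi), sub_self]

theorem inner_facetNormal_pos {Δ : Basis ι ℝ V} {δ : V} (h : IsObtuse Δ δ) {D : Finset ι}
    {i : ι} (hi : i ∈ D) : 0 < inner ℝ (facetNormal Δ δ D) (Δ i) := by
  rw [facetNormal, inner_sub_left, h.inner_delta]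
  have := inner_rhoPart_nonpos h (repr_rhoPart_eq_zero Δ δ (I := Dᶜ) (i := i) (by simpa using hi))
  linarith

theorem inner_facetNormal_nonneg {Δ : Basis ι ℝ V} {δ : V} (h : IsObtuse Δ δ) (D : Finset ι)
    (i : ι) : 0 ≤ inner ℝ (facetNormal Δ δ D) (Δ i) := by
  by_cases hi : i ∈ D
  · exact (inner_facetNormal_pos h hi).le
  · exact (inner_facetNormal_eq_zero h hi).ge

theorem facetNormal_injective {Δ : Basis ι ℝ V} {δ : V} (h : IsObtuse Δ δ) :
    Function.Injective (facetNormal Δ δ) := by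
  intro D E hDE
  ext i
  constructor <;> intro hi <;> by_contra hi'
  · have := inner_facetNormal_pos h hi
    rw [hDE, inner_facetNormal_eq_zero h hi'] at this
    exact this.false
  · have := inner_facetNormal_pos h hi
    rw [← hDE, inner_facetNormal_eq_zero h hi'] at this
    exact this.false

theorem eq_zero_of_inner_basis (Δ : Basis ι ℝ V) {y : V} (hy : ∀ i, inner ℝ y (Δ i) = (0 : ℝ)) :
    y = 0 :=
  InnerProductSpace.ext_inner_right_basis Δ fun i => by simpa using hy i

end RootBasis

/-! ### Flags of nonempty sets. -/

section Chains

variable {ι : Type*} [DecidableEq ι]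

/-- The finite chains of nonempty finite sets. -/
def IsFlag (S : Finset (Finset ι)) : Prop :=
  (∀ D ∈ S, D.Nonempty) ∧ ∀ D ∈ S, ∀ E ∈ S, D ⊆ E ∨ E ⊆ D

theorem IsFlag.mono {S T : Finset (Finset ι)} (hT : IsFlag T) (h : S ⊆ T) : IsFlag S :=
  ⟨fun D hD => hT.1 D (h hD), fun D hD E hE => hT.2 D (h hD) E (h hE)⟩

theorem IsFlag.exists_top {S : Finset (Finset ι)} (hS : IsFlag S) (hne : S.Nonempty) :
    ∃ D ∈ S, ∀ E ∈ S, E ⊆ D := by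
  obtain ⟨D, hD, hmax⟩ := S.exists_max_image Finset.card hne
  refine ⟨D, hD, fun E hE => ?_⟩
  rcases hS.2 D hD E hE with h | h
  · rw [Finset.eq_of_subset_of_card_le h (hmax E hE)]
  · exact h

theorem IsFlag.insert {S : Finset (Finset ι)} (hS : IsFlag S) {D : Finset ι} (hD : D.Nonempty)
    (h : ∀ E ∈ S, E ⊆ D) : IsFlag (insert D S) := by
  refine ⟨fun E hE => ?_, fun E hE F hF => ?_⟩
  · rcases Finset.mem_insert.1 hE with rfl | hE
    exacts [hD, hS.1 E hE]
  · rcases Finset.mem_insert.1 hE with rfl | hE <;> rcases Finset.mem_insert.1 hF with rfl | hF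
    · exact Or.inl subset_rfl
    · exact Or.inr (h F hF)
    · exact Or.inl (h E ‹_›)
    · exact hS.2 E hE F hF

/-- A nonempty flag has a top element, not contained in the union of the other ones. -/
theorem IsFlag.exists_mem_top {S : Finset (Finset ι)} (hS : IsFlag S) (hne : S.Nonempty) :
    ∃ D ∈ S, ∃ i ∈ D, ∀ E ∈ S, E ≠ D → i ∉ E := by
  obtain ⟨D, hD, htop⟩ := hS.exists_top hne
  refine ⟨D, hD, ?_⟩
  rcases (S.erase D).eq_empty_or_nonempty with h0 | h0
  · obtain ⟨i, hi⟩ := hS.1 D hD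
    refine ⟨i, hi, fun E hE hED => ?_⟩
    have : E ∈ S.erase D := Finset.mem_erase.2 ⟨hED, hE⟩
    simp [h0] at this
  · obtain ⟨F, hF, htopF⟩ := (hS.mono (S.erase_subset D)).exists_top h0
    rw [Finset.mem_erase] at hF
    have hFD : ¬ D ⊆ F := fun h => hF.1 ((htop F hF.2).antisymm h)
    obtain ⟨i, hiD, hiF⟩ := Finset.not_subset.1 hFD
    exact ⟨i, hiD, fun E hE hED hiE => hiF (htopF E (Finset.mem_erase.2 ⟨hED, hE⟩) hiE)⟩

end Chains

/-! ### The flag cones subdivide the dominant chamber. -/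

section Fan

variable {V : Type*} [NormedAddCommGroup V] [InnerProductSpace ℝ V] [FiniteDimensional ℝ V]
variable {ι : Type*} [Fintype ι] [DecidableEq ι]

/-- Among the members with nonzero coefficient, the top one has an index lying in no other; pairing
a relation with that simple root isolates its coefficient. -/
theorem linearIndepOn_facetNormal {Δ : Basis ι ℝ V} {δ : V} (h : IsObtuse Δ δ)
    {S : Finset (Finset ι)} (hS : IsFlag S) :
    LinearIndepOn ℝ (facetNormal Δ δ) (S : Set (Finset ι)) := by
  rw [linearIndepOn_finset_iff]
  intro g hg
  by_contra! hne
  obtain ⟨D₀, hD₀, hg₀⟩ := hne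
  obtain ⟨D, hD, i, hi, hE⟩ := (hS.mono (S.filter_subset fun D => g D ≠ 0)).exists_mem_top
    ⟨D₀, Finset.mem_filter.2 ⟨hD₀, hg₀⟩⟩
  rw [Finset.mem_filter] at hD
  have h1 : inner ℝ (∑ D ∈ S, g D • facetNormal Δ δ D) (Δ i) =
      g D * inner ℝ (facetNormal Δ δ D) (Δ i) := by
    rw [sum_inner, Finset.sum_eq_single_of_mem D hD.1, inner_smul_left]
    · rfl
    · intro E hES hED
      rw [inner_smul_left]
      by_cases hgE : g E = 0
      · simp [hgE]
      · rw [inner_facetNormal_eq_zero h (hE E (Finset.mem_filter.2 ⟨hES, hgE⟩) hED), mul_zero]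
  rw [hg, inner_zero_left] at h1
  exact (mul_ne_zero hD.2 (inner_facetNormal_pos h hi).ne') h1.symm

/-- Greedy descent: with `D` the support of `y`, subtract the largest multiple of `n_D` that keeps
`y` dominant. The support shrinks strictly, and the clause on supports ensures that the flag found
for the remainder lies strictly below `D`. -/
theorem exists_flag_combination {Δ : Basis ι ℝ V} {δ : V} (h : IsObtuse Δ δ) (y : V)
    (hy : ∀ i, 0 ≤ inner ℝ y (Δ i)) :
    ∃ S, IsFlag S ∧ (∀ D ∈ S, ∀ i ∈ D, inner ℝ y (Δ i) ≠ 0) ∧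
      ∃ w : Finset ι → ℝ, (∀ D ∈ S, 0 < w D) ∧ y = ∑ D ∈ S, w D • facetNormal Δ δ D := by
  induction hm : (Finset.univ.filter fun i => inner ℝ y (Δ i) ≠ 0).card using
    Nat.strong_induction_on generalizing y with
  | _ m ih =>
  set D := Finset.univ.filter fun i => inner ℝ y (Δ i) ≠ 0 with hDdef
  have hmemD : ∀ i, i ∈ D ↔ inner ℝ y (Δ i) ≠ 0 := by simp [hDdef]
  rcases D.eq_empty_or_nonempty with hD | hD
  · refine ⟨∅, ⟨by simp, by simp⟩, by simp, 0, by simp, ?_⟩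
    simp only [Finset.sum_empty]
    refine eq_zero_of_inner_basis Δ fun i => ?_
    by_contra h0
    have := (hmemD i).2 h0
    simp [hD] at this
  obtain ⟨j, hj, hmin⟩ := D.exists_min_image
    (fun i => inner ℝ y (Δ i) / inner ℝ (facetNormal Δ δ D) (Δ i)) hD
  set t := inner ℝ y (Δ j) / inner ℝ (facetNormal Δ δ D) (Δ j) with ht
  have htpos : 0 < t := div_pos ((hy j).lt_of_ne' ((hmemD j).1 hj)) (inner_facetNormal_pos h hj)
  have hin : ∀ i, inner ℝ (y - t • facetNormal Δ δ D) (Δ i) =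
      inner ℝ y (Δ i) - t * inner ℝ (facetNormal Δ δ D) (Δ i) := fun i => by
    rw [inner_sub_left, inner_smul_left]; rfl
  have hz : ∀ i, i ∉ D → inner ℝ (y - t • facetNormal Δ δ D) (Δ i) = 0 := fun i hi => by
    rw [hin, inner_facetNormal_eq_zero h hi, mul_zero, sub_zero]
    by_contra h0
    exact hi ((hmemD i).2 h0)
  have hzj : inner ℝ (y - t • facetNormal Δ δ D) (Δ j) = 0 := by
    rw [hin, ht, div_mul_cancel₀ _ (inner_facetNormal_pos h hj).ne', sub_self]
  have hsub : (Finset.univ.filter fun i => inner ℝ (y - t • facetNormal Δ δ D) (Δ i) ≠ 0) ⊂ D := by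
    refine Finset.ssubset_iff_subset_ne.2 ⟨fun i hi => ?_, fun heq => ?_⟩
    · by_contra hiD
      simp [hz i hiD] at hi
    · have hj' := hj
      rw [← heq] at hj'
      simp [hzj] at hj'
  obtain ⟨S, hS, hSD, w, hw, hsum⟩ := ih _ (hm ▸ Finset.card_lt_card hsub)
    (y - t • facetNormal Δ δ D) (fun i => by
      by_cases hi : i ∈ D
      · rw [hin, sub_nonneg]
        exact (le_div_iff₀ (inner_facetNormal_pos h hi)).1 (hmin i hi)
      · exact (hz i hi).ge) rfl
  have hSsub : ∀ E ∈ S, E ⊂ D := fun E hE => lt_of_le_of_lt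
    (fun i hi => by simpa using hSD E hE i hi) hsub
  have hDS : D ∉ S := fun hDS => (hSsub D hDS).ne rfl
  refine ⟨insert D S, hS.insert hD fun E hE => (hSsub E hE).subset, ?_,
    Function.update w D t, ?_, ?_⟩
  · intro E hE i hi
    rcases Finset.mem_insert.1 hE with rfl | hE
    · exact (hmemD i).1 hi
    · exact (hmemD i).1 ((hSsub E hE).subset hi)
  · intro E hE
    rcases Finset.mem_insert.1 hE with rfl | hE
    · simpa using htpos
    · rw [Function.update_of_ne (fun h => hDS (by rwa [h] at hE) : E ≠ D)]
      exact hw E hE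
  · rw [Finset.sum_insert hDS, Function.update_self, Finset.sum_congr (g := fun E => w E • facetNormal Δ δ E)
      rfl fun E hE => by rw [Function.update_of_ne (fun h => hDS (by rwa [h] at hE) : E ≠ D)], ← hsum, add_sub_cancel]

end Fan

/-! ### Greedy choice of the coordinates of a tight point. -/

section Weights

variable {ι : Type*} [DecidableEq ι]

/-- Coefficients `C I i > 0`, `i ∈ I`, and numbers `e j > 0` such that the quotients
`C I i / e |I|` drop by a factor of more than two whenever `I` is enlarged. -/
structure IsGapped (C : Finset ι → ι → ℝ) (e : ℕ → ℝ) : Prop where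
  coeff_pos : ∀ I, ∀ i ∈ I, 0 < C I i
  pos : ∀ I : Finset ι, I.Nonempty → 0 < e I.card
  gap : ∀ I a i, a ∉ I → i ∈ I → 2 * C (insert a I) i * e I.card < C I i * e (I.card + 1)

theorem IsGapped.two_mul_lt {C : Finset ι → ι → ℝ} {e : ℕ → ℝ} (h : IsGapped C e)
    {I J : Finset ι} (hIJ : I ⊂ J) {i : ι} (hi : i ∈ I) :
    2 * C J i * e I.card < C I i * e J.card := by
  induction J using Finset.strongInduction with
  | H J ih =>
  obtain ⟨a, haJ, haI⟩ := Finset.exists_of_ssubset hIJ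
  have hsub : I ⊆ J.erase a := fun j hj => Finset.mem_erase.2
    ⟨fun hja => haI (hja ▸ hj), hIJ.subset hj⟩
  have hgap := h.gap (J.erase a) a i (Finset.notMem_erase a J) (hsub hi)
  rw [Finset.insert_erase haJ, Finset.card_erase_add_one haJ] at hgap
  rcases hsub.eq_or_ssubset with heq | hss
  · rwa [← heq] at hgap
  · have h1 := ih _ (Finset.erase_ssubset haJ) hss
    have hI := h.pos I ⟨i, hi⟩
    have hE := h.pos (J.erase a) ⟨i, hsub hi⟩
    have hJ := h.pos J ⟨i, hIJ.subset hi⟩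
    have hc := h.coeff_pos I i hi
    have hc' := h.coeff_pos _ i (hsub hi)
    have h2 : 2 * C J i * e I.card * e (J.erase a).card <
        C I i * e J.card * e (J.erase a).card := by
      calc _ = (2 * C J i * e (J.erase a).card) * e I.card := by ring
        _ < (C (J.erase a) i * e J.card) * e I.card := by gcongr
        _ ≤ (2 * C (J.erase a) i * e I.card) * e J.card := by
          have : 0 ≤ C (J.erase a) i * e J.card * e I.card := by positivity
          linarith
        _ ≤ (C I i * e (J.erase a).card) * e J.card := by gcongr
        _ = _ := by ring
    exact lt_of_mul_lt_mul_right h2 hE.le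

/-- Indices are added in order of increasing `g`, each new coordinate being chosen to make the
enlarged set an equality. The equalities then occur only at the successive sets of this process,
hence at most once for each cardinality, and every set closed downwards for `g` is among them. -/
theorem IsGapped.exists_weights {C : Finset ι → ι → ℝ} {e : ℕ → ℝ} (h : IsGapped C e)
    (g : ι → ℕ) (s : Finset ι) :
    ∃ x : ι → ℝ, (∀ i ∈ s, 0 < x i) ∧
      (∀ I ⊆ s, I.Nonempty → e I.card ≤ ∑ i ∈ I, C I i * x i) ∧
      (∀ I ⊆ s, ∀ J ⊆ s, I.Nonempty → I.card = J.card → e I.card = ∑ i ∈ I, C I i * x i →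
        e J.card = ∑ i ∈ J, C J i * x i → I = J) ∧
      (∀ I ⊆ s, I.Nonempty → (∀ i ∈ I, ∀ j ∈ s, g j ≤ g i → j ∈ I) →
        e I.card = ∑ i ∈ I, C I i * x i) := by
  induction s using Finset.induction_on_max_value g with
  | empty =>
    have : ∀ I ⊆ (∅ : Finset ι), ¬ I.Nonempty := fun I hI => by
      simp [Finset.subset_empty.1 hI]
    exact ⟨0, by simp, fun I hI hne => absurd hne (this I hI),
      fun I hI _ _ hne => absurd hne (this I hI), fun I hI hne => absurd hne (this I hI)⟩
  | insert a s has hmax ih =>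
  obtain ⟨x, hxpos, hge, huniq, heq⟩ := ih
  have hs'ne : (insert a s).Nonempty := Finset.insert_nonempty a s
  have hca := h.coeff_pos (insert a s) a (Finset.mem_insert_self a s)
  have hes' := h.pos _ hs'ne
  -- The old set `s` is an equality, so the gap leaves its indices less than half of the new right
  -- hand side.
  have hsum : ∑ i ∈ s, C (insert a s) i * x i < e (insert a s).card / 2 := by
    rcases s.eq_empty_or_nonempty with rfl | hsne
    · simpa using hes'
    · have hes := h.pos s hsne
      have h1 : 2 * e s.card * ∑ i ∈ s, C (insert a s) i * x i <
          e s.card * e (insert a s).card := by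
        calc _ = ∑ i ∈ s, (2 * C (insert a s) i * e s.card) * x i := by
              rw [Finset.mul_sum]; exact Finset.sum_congr rfl fun i _ => by ring
          _ < ∑ i ∈ s, (C s i * e (insert a s).card) * x i :=
              Finset.sum_lt_sum_of_nonempty hsne fun i hi => mul_lt_mul_of_pos_right
                (h.two_mul_lt (Finset.ssubset_insert has) hi) (hxpos i hi)
          _ = (∑ i ∈ s, C s i * x i) * e (insert a s).card := by
              rw [Finset.sum_mul]; exact Finset.sum_congr rfl fun i _ => by ring
          _ = _ := by rw [← heq s subset_rfl hsne fun _ _ j hj _ => hj]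
      have h2 : 0 < e s.card := hes
      nlinarith
  set xa := (e (insert a s).card - ∑ i ∈ s, C (insert a s) i * x i) / C (insert a s) a with hxa
  have hxa' : C (insert a s) a * xa =
      e (insert a s).card - ∑ i ∈ s, C (insert a s) i * x i := by
    rw [hxa]; field_simp
  have hxahalf : e (insert a s).card < 2 * (C (insert a s) a * xa) := by linarith
  have hxapos : 0 < xa := by
    have : 0 < C (insert a s) a * xa := by linarith
    exact pos_of_mul_pos_right this hca.le
  have hne : ∀ i ∈ s, i ≠ a := fun i hi hia => has (hia ▸ hi)
  set y := Function.update x a xa with hy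
  have hyx : ∀ I ⊆ s, ∑ i ∈ I, C I i * y i = ∑ i ∈ I, C I i * x i := fun I hI =>
    Finset.sum_congr rfl fun i hi => by rw [hy, Function.update_of_ne (hne i (hI hi))]
  have hypos : ∀ i ∈ insert a s, 0 < y i := fun i hi => by
    rcases Finset.mem_insert.1 hi with rfl | hi
    · simpa [hy] using hxapos
    · rw [hy, Function.update_of_ne (hne i hi)]
      exact hxpos i hi
  have hfull : e (insert a s).card = ∑ i ∈ insert a s, C (insert a s) i * y i := by
    have hrest : ∑ i ∈ s, C (insert a s) i * y i = ∑ i ∈ s, C (insert a s) i * x i :=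
      Finset.sum_congr rfl fun i hi => by rw [hy, Function.update_of_ne (hne i hi)]
    rw [Finset.sum_insert has, hrest, hy, Function.update_self, hxa', sub_add_cancel]
  have hsmall : ∀ I ⊆ insert a s, a ∉ I → I ⊆ s := fun I hI haI i hi =>
    (Finset.mem_insert.1 (hI hi)).resolve_left fun hia => haI (hia ▸ hi)
  -- The term of `a` carries more than half of the total on the full set; on a smaller set the gap
  -- makes this single term exceed `e I.card`.
  have hstrict : ∀ I ⊂ insert a s, a ∈ I → e I.card < ∑ i ∈ I, C I i * y i := by
    intro I hI haI
    have h1 := h.two_mul_lt hI haI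
    have h2 : C I a * xa ≤ ∑ i ∈ I, C I i * y i := by
      have := Finset.single_le_sum (f := fun i => C I i * y i) (fun i hi =>
        (mul_pos (h.coeff_pos I i hi) (hypos i (hI.subset hi))).le) haI
      simpa [hy] using this
    refine lt_of_lt_of_le ?_ h2
    have hI0 := h.pos I ⟨a, haI⟩
    have h3 : e I.card * e (insert a s).card < C I a * xa * e (insert a s).card := by
      calc _ < e I.card * (2 * (C (insert a s) a * xa)) := by gcongr
        _ = (2 * C (insert a s) a * e I.card) * xa := by ring
        _ ≤ (C I a * e (insert a s).card) * xa := by gcongr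
        _ = _ := by ring
    exact lt_of_mul_lt_mul_right h3 hes'.le
  have hcases : ∀ I ⊆ insert a s, e I.card = ∑ i ∈ I, C I i * y i →
      I ⊆ s ∧ e I.card = ∑ i ∈ I, C I i * x i ∨ I = insert a s := by
    intro I hI hIe
    by_cases haI : a ∈ I
    · rcases hI.eq_or_ssubset with h1 | h1
      · exact Or.inr h1
      · exact absurd hIe (hstrict I h1 haI).ne
    · have := hsmall I hI haI
      exact Or.inl ⟨this, by rwa [hyx I this] at hIe⟩
  refine ⟨y, hypos, ?_, ?_, ?_⟩
  · intro I hI hIne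
    by_cases haI : a ∈ I
    · rcases hI.eq_or_ssubset with rfl | h1
      · exact hfull.le
      · exact (hstrict I h1 haI).le
    · rw [hyx I (hsmall I hI haI)]
      exact hge I (hsmall I hI haI) hIne
  · intro I hI J hJ hIne hcard hIe hJe
    rcases hcases I hI hIe with ⟨h1, h1'⟩ | h1
    · rcases hcases J hJ hJe with ⟨h2, h2'⟩ | h2
      · exact huniq I h1 J h2 hIne hcard h1' h2'
      · exact Finset.eq_of_subset_of_card_le (h2 ▸ hI) hcard.ge |>.trans (by rw [h2])
    · exact (Finset.eq_of_subset_of_card_le (h1 ▸ hJ) hcard.le).symm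
  · intro I hI hIne hsat
    by_cases haI : a ∈ I
    · have : I = insert a s := hI.antisymm fun j hj => by
        refine hsat a haI j hj ?_
        rcases Finset.mem_insert.1 hj with rfl | hj
        exacts [le_rfl, hmax j hj]
      subst this
      exact hfull
    · rw [hyx I (hsmall I hI haI)]
      exact heq I (hsmall I hI haI) hIne fun i hi j hj hji =>
        hsat i hi j (Finset.mem_insert_of_mem hj) hji

end Weights

/-! ### A point where exactly the inequalities of a given flag are equalities. -/

section TightPoints

variable {V : Type*} [NormedAddCommGroup V] [InnerProductSpace ℝ V] [FiniteDimensional ℝ V]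
variable {ι : Type*} [Fintype ι] [DecidableEq ι]

/-- The right hand side of the inequality with the normal `facetNormal Δ δ D`. -/
def facetBound (ι : Type*) [Fintype ι] [DecidableEq ι] (ε : ℕ → ℝ) (D : Finset ι) : ℝ :=
  if D = Finset.univ then ε (Fintype.card ι) else ε (Fintype.card ι) - ε Dᶜ.card

theorem IsGapped.eventually {C : Finset ι → ι → ℝ} {e : ℕ → ℝ} (h : IsGapped C e) (r : ℕ → ℝ) :
    ∀ᶠ s : ℝ in nhds 0, IsGapped C fun j => e j + s * r j := by
  have h1 : ∀ I : Finset ι, ∀ᶠ s : ℝ in nhds 0, I.Nonempty → 0 < e I.card + s * r I.card := by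
    intro I
    by_cases hI : I.Nonempty
    · have hc : ContinuousAt (fun s : ℝ => e I.card + s * r I.card) 0 := by fun_prop
      filter_upwards [hc.eventually_const_lt (u := 0) (by simpa using h.pos I hI)] with s hs _
        using hs
    · simp [hI]
  have h2 : ∀ I : Finset ι, ∀ a i, ∀ᶠ s : ℝ in nhds 0, a ∉ I → i ∈ I →
      2 * C (insert a I) i * (e I.card + s * r I.card) <
        C I i * (e (I.card + 1) + s * r (I.card + 1)) := by
    intro I a i
    by_cases ha : a ∉ I
    · by_cases hi : i ∈ I
      · have hc : ContinuousAt (fun s : ℝ => 2 * C (insert a I) i * (e I.card + s * r I.card)) 0 := by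
          fun_prop
        have hc' : ContinuousAt (fun s : ℝ => C I i * (e (I.card + 1) + s * r (I.card + 1))) 0 := by
          fun_prop
        filter_upwards [hc.eventually_lt hc' (by simpa using h.gap I a i ha hi)] with s hs _ _
          using hs
      · simp [hi]
    · simp only [ha, false_implies, Filter.eventually_true]
  filter_upwards [Filter.eventually_all.2 h1, Filter.eventually_all.2 fun I =>
    Filter.eventually_all.2 fun a => Filter.eventually_all.2 fun i => h2 I a i] with s hs1 hs2
  exact ⟨h.coeff_pos, hs1, hs2⟩

theorem exists_inner_basis_eq (Δ : Basis ι ℝ V) (x : ι → ℝ) : ∃ v : V, ∀ i, inner ℝ v (Δ i) = x i :=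
  ⟨(InnerProductSpace.toDual ℝ V).symm (LinearMap.toContinuousLinearMap (Δ.constr ℝ x)), fun i => by
    simp⟩

theorem inner_rhoPart_eq_sum (Δ : Basis ι ℝ V) (δ v : V) (I : Finset ι) :
    inner ℝ v (rhoPart Δ δ I) = ∑ i ∈ I, Δ.repr (rhoPart Δ δ I) i * inner ℝ v (Δ i) := by
  rw [real_inner_comm, inner_eq_sum_repr Δ]
  refine (Finset.sum_subset (Finset.subset_univ I) fun i _ hi => ?_).symm.trans
    (Finset.sum_congr rfl fun i _ => by rw [real_inner_comm])
  rw [repr_rhoPart_eq_zero Δ δ hi, zero_mul]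

/-- The weights are built for the perturbed list `ε j + s * (η j - θ)`. A cardinality with `η = 1`
receives a slack `s`; for one used by the flag, uniqueness of the equality excludes every set but
the right one. The number `θ` decides whether `(v, δ) = a` holds, and cancels in all other
inequalities. -/
theorem exists_tight_point [Nonempty ι] (Δ : Basis ι ℝ V) (δ : V) (ε : ℕ → ℝ)
    (h : IsGapped (fun I i => Δ.repr (rhoPart Δ δ I) i) ε) {S : Finset (Finset ι)}
    (hS : IsFlag S) :
    ∃ v : V, (∀ i, 0 < inner ℝ v (Δ i)) ∧ ∀ D : Finset ι, D.Nonempty →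
      (D ∈ S → inner ℝ v (facetNormal Δ δ D) = facetBound ι ε D) ∧
      (D ∉ S → inner ℝ v (facetNormal Δ δ D) < facetBound ι ε D) := by
  classical
  set θ : ℝ := if Finset.univ ∈ S then 0 else 1 with hθ
  set η : ℕ → ℝ := fun j => if j = Fintype.card ι ∨ ∃ D ∈ S, Dᶜ.card = j then 0 else 1 with hη
  obtain ⟨s, hs, hspos⟩ := (((h.eventually fun j => η j - θ).filter_mono
    nhdsWithin_le_nhds).and (self_mem_nhdsWithin (s := Set.Ioi (0 : ℝ)))).exists
  replace hspos : 0 < s := hspos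
  -- Counting the members of `S` that contain an index makes the complements of these members
  -- downward closed.
  obtain ⟨x, hx, hge, huniq, heq⟩ :=
    hs.exists_weights (fun i => (S.filter fun D => i ∈ D).card) Finset.univ
  obtain ⟨v, hv⟩ := exists_inner_basis_eq Δ x
  have hinner : ∀ I, inner ℝ v (rhoPart Δ δ I) = ∑ i ∈ I, Δ.repr (rhoPart Δ δ I) i * x i :=
    fun I => by simp only [inner_rhoPart_eq_sum, hv]
  simp only [← hinner] at hge huniq heq
  have hsat : ∀ D ∈ S, D ≠ Finset.univ → ε Dᶜ.card + s * (η Dᶜ.card - θ) =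
      inner ℝ v (rhoPart Δ δ Dᶜ) := by
    intro D hD hDu
    refine heq _ (Finset.subset_univ _) (by
      rw [Finset.nonempty_iff_ne_empty, Ne, Finset.compl_eq_empty_iff]; exact hDu) ?_
    intro i hi j _ hji
    rw [Finset.mem_compl] at hi ⊢
    intro hjD
    refine absurd hji (not_le.2 (Finset.card_lt_card (Finset.ssubset_iff_subset_ne.2 ⟨?_, ?_⟩)))
    · intro E hE
      rw [Finset.mem_filter] at hE ⊢
      exact ⟨hE.1, ((hS.2 D hD E hE.1).resolve_right fun hED => hi (hED hE.2)) hjD⟩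
    · intro hEq
      have : D ∈ S.filter fun D => j ∈ D := Finset.mem_filter.2 ⟨hD, hjD⟩
      rw [← hEq, Finset.mem_filter] at this
      exact hi this.2
  have htop : inner ℝ v δ = ε (Fintype.card ι) - s * θ := by
    have h1 := heq Finset.univ subset_rfl Finset.univ_nonempty fun _ _ j _ _ => Finset.mem_univ j
    rw [rhoPart_univ, Finset.card_univ] at h1
    rw [← h1]
    simp [hη]
    ring
  refine ⟨v, fun i => (hv i).symm ▸ hx i (Finset.mem_univ i), fun D hDne => ?_⟩
  rw [facetNormal, inner_sub_right, htop, facetBound]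
  by_cases hDu : D = Finset.univ
  · subst hDu
    rw [if_pos rfl, Finset.compl_univ, rhoPart_empty, inner_zero_right]
    constructor <;> intro hD
    · simp [hθ, hD]
    · simp [hθ, hD, hspos]
  rw [if_neg hDu]
  have hDc : Dᶜ.Nonempty := by
    rw [Finset.nonempty_iff_ne_empty, Ne, Finset.compl_eq_empty_iff]; exact hDu
  have hcard : Dᶜ.card ≠ Fintype.card ι := fun hc => by
    rw [Finset.card_eq_iff_eq_univ, Finset.compl_eq_univ_iff] at hc
    exact hDne.ne_empty hc
  constructor <;> intro hD
  · have h1 := hsat D hD hDu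
    have h2 : η Dᶜ.card = 0 := if_pos (Or.inr ⟨D, hD, rfl⟩)
    rw [h2] at h1
    linarith
  · have h1 := hge Dᶜ (Finset.subset_univ _) hDc
    by_cases hE : ∃ E ∈ S, Eᶜ.card = Dᶜ.card
    · have h2 : η Dᶜ.card = 0 := if_pos (Or.inr hE)
      obtain ⟨E, hES, hEc⟩ := hE
      have hEu : E ≠ Finset.univ := fun hEu => by
        rw [hEu, Finset.compl_univ, Finset.card_empty] at hEc
        exact hDc.card_pos.ne hEc
      have h3 := h1.lt_of_ne fun h3 => hD (by
        have := huniq Dᶜ (Finset.subset_univ _) Eᶜ (Finset.subset_univ _) hDc hEc.symm h3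
          (hsat E hES hEu)
        rwa [compl_injective this])
      rw [h2] at h3
      linarith
    · have h2 : η Dᶜ.card = 1 := if_neg (by rintro (h | h); exacts [hcard h, hE h])
      rw [h2] at h1
      linarith

end TightPoints

/-! ### Comparing sizes of images. -/

section Orbits

theorem ncard_image_eq_ncard_image {α β γ : Type*} {s : Set α} {f : α → β} {g : α → γ}
    (h : ∀ a ∈ s, ∀ b ∈ s, f a = f b ↔ g a = g b) : (f '' s).ncard = (g '' s).ncard := by
  rcases s.eq_empty_or_nonempty with rfl | ⟨a₀, ha₀⟩
  · simp
  have : Nonempty α := ⟨a₀⟩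
  have hinv : ∀ a ∈ s, f (Function.invFunOn g s (g a)) = f a := fun a ha =>
    (h _ (Function.invFunOn_mem ⟨a, ha, rfl⟩) a ha).2 (Function.invFunOn_eq ⟨a, ha, rfl⟩)
  have himg : f '' s = (fun y => f (Function.invFunOn g s y)) '' (g '' s) := by
    rw [Set.image_image]
    exact Set.image_congr fun a ha => (hinv a ha).symm
  rw [himg, Set.InjOn.ncard_image]
  rintro _ ⟨a, ha, rfl⟩ _ ⟨b, hb, rfl⟩ hab
  simp only [hinv a ha, hinv b hb] at hab
  exact (h a ha b hb).1 hab

end Orbits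

/-! ### Faces as group images of flags. -/

section Reflections

variable {V : Type*} [NormedAddCommGroup V] [InnerProductSpace ℝ V] [FiniteDimensional ℝ V]
variable {ι : Type*} [Fintype ι] [DecidableEq ι]

/-- A finite group of isometries for which the cone of the dominant vectors is a fundamental
domain, such that the maximum of `(v, σ u)` for `v`, `u` dominant and `v` regular is attained only
at `σ u = u`. -/
structure HasChamber (Δ : Basis ι ℝ V) (W : Subgroup (V ≃ₗᵢ[ℝ] V)) : Prop where
  finite : (W : Set (V ≃ₗᵢ[ℝ] V)).Finite
  exists_dominant : ∀ y : V, ∃ σ ∈ W, ∀ i, 0 ≤ inner ℝ (σ y) (Δ i)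
  inner_lt : ∀ v u : V, (∀ i, 0 < inner ℝ v (Δ i)) → (∀ i, 0 ≤ inner ℝ u (Δ i)) →
    ∀ σ ∈ W, σ u ≠ u → inner ℝ v (σ u) < inner ℝ v u

variable {Δ : Basis ι ℝ V} {W : Subgroup (V ≃ₗᵢ[ℝ] V)} {δ : V}

theorem HasChamber.inner_le (hW : HasChamber Δ W) {v u : V} (hv : ∀ i, 0 < inner ℝ v (Δ i))
    (hu : ∀ i, 0 ≤ inner ℝ u (Δ i)) {σ : V ≃ₗᵢ[ℝ] V} (hσ : σ ∈ W) :
    inner ℝ v (σ u) ≤ inner ℝ v u := by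
  by_cases h : σ u = u
  · rw [h]
  · exact (hW.inner_lt v u hv hu σ hσ h).le

/-- Two dominant vectors in one orbit both maximize the product with a regular dominant `v` over it,
and the maximizer is unique. -/
theorem HasChamber.eq_of_apply_eq (hW : HasChamber Δ W) {u w : V}
    (hu : ∀ i, 0 ≤ inner ℝ u (Δ i)) (hw : ∀ i, 0 ≤ inner ℝ w (Δ i)) {σ τ : V ≃ₗᵢ[ℝ] V}
    (hσ : σ ∈ W) (hτ : τ ∈ W) (h : σ u = τ w) : u = w := by
  obtain ⟨v, hv⟩ := exists_inner_basis_eq Δ fun _ => 1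
  have hv' : ∀ i, 0 < inner ℝ v (Δ i) := fun i => by rw [hv]; exact one_pos
  have h1 : (τ⁻¹ * σ) u = w := by
    rw [LinearIsometryEquiv.coe_mul, Function.comp_apply, h]; exact τ.symm_apply_apply w
  have h2 : (σ⁻¹ * τ) w = u := by
    rw [LinearIsometryEquiv.coe_mul, Function.comp_apply, ← h]; exact σ.symm_apply_apply u
  by_contra hne
  have h3 := hW.inner_lt v u hv' hu _ (W.mul_mem (W.inv_mem hτ) hσ) (by rw [h1]; exact Ne.symm hne)
  have h4 := hW.inner_le hv' hw (W.mul_mem (W.inv_mem hσ) hτ)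
  rw [h1] at h3
  rw [h2] at h4
  exact absurd h3 (not_lt.2 h4)

theorem HasChamber.index_eq (hW : HasChamber Δ W) (hΔ : IsObtuse Δ δ) {D E : Finset ι}
    {σ τ : V ≃ₗᵢ[ℝ] V} (hσ : σ ∈ W) (hτ : τ ∈ W)
    (h : σ (facetNormal Δ δ D) = τ (facetNormal Δ δ E)) : D = E :=
  facetNormal_injective hΔ (hW.eq_of_apply_eq (inner_facetNormal_nonneg hΔ D)
    (inner_facetNormal_nonneg hΔ E) hσ hτ h)

/-- An element that fixes a dominant vector fixes the dominant vectors with smaller support. -/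
theorem HasChamber.fixes_of_subset (hW : HasChamber Δ W) (hΔ : IsObtuse Δ δ) {D E : Finset ι}
    (hED : E ⊆ D) {σ : V ≃ₗᵢ[ℝ] V} (hσ : σ ∈ W)
    (h : σ (facetNormal Δ δ D) = facetNormal Δ δ D) :
    σ (facetNormal Δ δ E) = facetNormal Δ δ E := by
  obtain ⟨v, hv⟩ := exists_inner_basis_eq Δ fun _ => 1
  have hv' : ∀ i, 0 < inner ℝ v (Δ i) := fun i => by rw [hv]; exact one_pos
  set u := facetNormal Δ δ D with hu
  set w := facetNormal Δ δ E with hw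
  -- For small `s > 0` the vector `u - s • w` is still dominant. If `σ` fixed `u` but moved `w`, it
  -- would increase the product of this vector with `v`.
  have hev : ∀ᶠ s : ℝ in nhds 0, ∀ i ∈ D, 0 < inner ℝ (u - s • w) (Δ i) := by
    rw [Filter.eventually_all_finset]
    intro i hi
    have hc : ContinuousAt (fun s : ℝ => inner ℝ (u - s • w) (Δ i)) 0 := by fun_prop
    exact hc.eventually_const_lt (by simpa using inner_facetNormal_pos hΔ hi)
  obtain ⟨s, hs, hspos⟩ := ((hev.filter_mono nhdsWithin_le_nhds).and
    (self_mem_nhdsWithin (s := Set.Ioi (0 : ℝ)))).exists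
  replace hspos : 0 < s := hspos
  have hdom : ∀ i, 0 ≤ inner ℝ (u - s • w) (Δ i) := fun i => by
    by_cases hi : i ∈ D
    · exact (hs i hi).le
    · rw [inner_sub_left, inner_smul_left, inner_facetNormal_eq_zero hΔ hi,
        inner_facetNormal_eq_zero hΔ fun hE => hi (hED hE)]
      simp
  by_contra hne
  have h1 := hW.inner_lt v w hv' (inner_facetNormal_nonneg hΔ E) σ hσ hne
  have h2 := hW.inner_le hv' hdom hσ
  rw [map_sub, map_smul, h, inner_sub_right, inner_sub_right, inner_smul_right,
    inner_smul_right] at h2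
  nlinarith

/-- The polytope cut out by the images of the half-spaces of the `facetNormal`s. -/
def flagPolytope (Δ : Basis ι ℝ V) (W : Subgroup (V ≃ₗᵢ[ℝ] V)) (δ : V) (ε : ℕ → ℝ) : Set V :=
  {x | ∀ σ ∈ W, ∀ D : Finset ι, D.Nonempty →
    inner ℝ x (σ (facetNormal Δ δ D)) ≤ facetBound ι ε D}

open Classical in
/-- The normals of the facets that contain the face of the flag `S` and of `σ`. -/
def normalSet (Δ : Basis ι ℝ V) (δ : V) (S : Finset (Finset ι)) (σ : V ≃ₗᵢ[ℝ] V) : Finset V :=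
  S.image fun D => σ (facetNormal Δ δ D)

theorem injective_apply_facetNormal (hΔ : IsObtuse Δ δ) (σ : V ≃ₗᵢ[ℝ] V) :
    Function.Injective fun D => σ (facetNormal Δ δ D) :=
  σ.injective.comp (facetNormal_injective hΔ)

theorem ncard_facesOfCodim_flagPolytope [Nonempty ι] (hW : HasChamber Δ W) (hΔ : IsObtuse Δ δ)
    (ε : ℕ → ℝ) (hε : IsGapped (fun I i => Δ.repr (rhoPart Δ δ I) i) ε) (c : ℕ) :
    (facesOfCodim (flagPolytope Δ W δ ε) c).ncard =
      {T | ∃ S, (IsFlag S ∧ S.card = c) ∧ ∃ σ ∈ W, normalSet Δ δ S σ = T}.ncard := by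
  classical
  -- A bound depending only on the normal vector exists because the normal determines `D`, by
  -- `HasChamber.index_eq`.
  obtain ⟨b, hb⟩ : ∃ b : V → ℝ, ∀ σ ∈ W, ∀ D, b (σ (facetNormal Δ δ D)) = facetBound ι ε D := by
    refine ⟨Function.extend (fun p : W × Finset ι => p.1.1 (facetNormal Δ δ p.2))
      (fun p => facetBound ι ε p.2) 0, fun σ hσ D => ?_⟩
    refine Function.FactorsThrough.extend_apply (g := fun p : W × Finset ι => facetBound ι ε p.2)
      (f := fun p : W × Finset ι => p.1.1 (facetNormal Δ δ p.2)) ?_ 0 (⟨⟨σ, hσ⟩, D⟩)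
    rintro ⟨τ, E⟩ ⟨τ', E'⟩ h
    rw [show E = E' from hW.index_eq hΔ τ.2 τ'.2 h]
  set N : Set V := {u | ∃ σ ∈ W, ∃ D : Finset ι, D.Nonempty ∧ σ (facetNormal Δ δ D) = u} with hN
  set K : Set (Finset V) := {T | ∃ S, IsFlag S ∧ ∃ σ ∈ W, normalSet Δ δ S σ = T} with hKdef
  have hNfin : N.Finite := by
    refine ((hW.finite.prod (Set.finite_univ (α := Finset ι))).image
      fun p => p.1 (facetNormal Δ δ p.2)).subset ?_
    rintro _ ⟨σ, hσ, D, -, rfl⟩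
    exact ⟨(σ, D), ⟨hσ, trivial⟩, rfl⟩
  have hP : flagPolytope Δ W δ ε = polyhedron N b := by
    ext x
    constructor
    · rintro hx _ ⟨σ, hσ, D, hD, rfl⟩
      rw [hb σ hσ]
      exact hx σ hσ D hD
    · intro hx σ hσ D hD
      rw [← hb σ hσ]
      exact hx _ ⟨σ, hσ, D, hD, rfl⟩
  rw [hP, ncard_facesOfCodim_polyhedron hNfin b K]
  · congr 1
    ext T
    constructor
    · rintro ⟨⟨S, hS, σ, hσ, rfl⟩, hc⟩
      refine ⟨S, ⟨hS, ?_⟩, σ, hσ, rfl⟩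
      rwa [normalSet, Finset.card_image_of_injective _ (injective_apply_facetNormal hΔ σ)] at hc
    · rintro ⟨S, ⟨hS, hc⟩, σ, hσ, rfl⟩
      refine ⟨⟨S, hS, σ, hσ, rfl⟩, ?_⟩
      rwa [normalSet, Finset.card_image_of_injective _ (injective_apply_facetNormal hΔ σ)]
  · rintro _ ⟨S, hS, σ, hσ, rfl⟩ u hu
    obtain ⟨D, hD, rfl⟩ := Finset.mem_image.1 hu
    exact ⟨σ, hσ, D, hS.1 D hD, rfl⟩
  · rintro _ ⟨S, hS, σ, hσ, rfl⟩
    have h1 := (linearIndepOn_facetNormal hΔ hS).map_injOn σ.toLinearEquiv.toLinearMap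
      σ.injective.injOn
    have h2 := h1.id_image
    rw [normalSet, Finset.coe_image]
    exact h2
  · exact ⟨∅, ⟨by simp, by simp⟩, 1, W.one_mem, by simp [normalSet]⟩
  · intro y
    obtain ⟨σ, hσ, hy⟩ := hW.exists_dominant y
    obtain ⟨S, hS, -, w, hw, hsum⟩ := exists_flag_combination hΔ (σ y) hy
    have hinj := facetNormal_injective hΔ
    refine ⟨_, ⟨S, hS, σ⁻¹, W.inv_mem hσ, rfl⟩,
      fun u => w (Function.invFun (facetNormal Δ δ) (σ u)), ?_, ?_⟩
    · intro u hu
      obtain ⟨D, hD, rfl⟩ := Finset.mem_image.1 hu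
      have : σ (σ⁻¹ (facetNormal Δ δ D)) = facetNormal Δ δ D := σ.apply_symm_apply _
      simp only [this, Function.leftInverse_invFun hinj D]
      exact hw D hD
    · rw [normalSet, Finset.sum_image fun D _ E _ h => injective_apply_facetNormal hΔ _ h]
      have : ∀ D, σ (σ⁻¹ (facetNormal Δ δ D)) = facetNormal Δ δ D := fun D => σ.apply_symm_apply _
      simp only [this, Function.leftInverse_invFun hinj _]
      have h2 := congrArg (σ⁻¹ : V ≃ₗᵢ[ℝ] V) hsum
      rw [show (σ⁻¹ : V ≃ₗᵢ[ℝ] V) (σ y) = y from σ.symm_apply_apply y, map_sum] at h2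
      simpa only [map_smul] using h2
  · rintro _ ⟨S, hS, σ, hσ, rfl⟩
    obtain ⟨v, hv, hvS⟩ := exists_tight_point Δ δ ε hε hS
    refine ⟨σ v, fun u hu => ?_, ?_⟩
    · obtain ⟨D, hD, rfl⟩ := Finset.mem_image.1 hu
      rw [hb σ hσ, LinearIsometryEquiv.inner_map_map]
      exact (hvS D (hS.1 D hD)).1 hD
    · rintro _ ⟨τ, hτ, D, hD, rfl⟩ hnot
      rw [hb τ hτ]
      have h1 : inner ℝ (σ v) (τ (facetNormal Δ δ D)) =
          inner ℝ v ((σ⁻¹ * τ) (facetNormal Δ δ D)) := by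
        have h0 : σ ((σ⁻¹ * τ) (facetNormal Δ δ D)) = τ (facetNormal Δ δ D) :=
          σ.apply_symm_apply _
        rw [← h0, LinearIsometryEquiv.inner_map_map]
      rw [h1]
      -- Either the normal is that of `D` itself, moved by `σ`, and `D ∉ S`; or the strict chamber
      -- inequality compares it with the one for `D`, which holds at `v`.
      by_cases hfix : (σ⁻¹ * τ) (facetNormal Δ δ D) = facetNormal Δ δ D
      · rw [hfix]
        refine (hvS D hD).2 fun hDS => hnot (Finset.mem_image.2 ⟨D, hDS, ?_⟩)
        exact (congrArg σ hfix).symm.trans (σ.apply_symm_apply _)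
      · refine (hW.inner_lt v _ hv (inner_facetNormal_nonneg hΔ D) _
          (W.mul_mem (W.inv_mem hσ) hτ) hfix).trans_le ?_
        by_cases hDS : D ∈ S
        · exact ((hvS D hD).1 hDS).le
        · exact ((hvS D hD).2 hDS).le

open Classical in
/-- The flags of cardinality `c` with top element `D`. -/
def flagsWithTop (c : ℕ) (D : Finset ι) : Finset (Finset (Finset ι)) :=
  Finset.univ.filter fun S => IsFlag S ∧ S.card = c ∧ D ∈ S ∧ ∀ E ∈ S, E ⊆ D

theorem mem_flagsWithTop {c : ℕ} {D : Finset ι} {S : Finset (Finset ι)} :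
    S ∈ flagsWithTop c D ↔ IsFlag S ∧ S.card = c ∧ D ∈ S ∧ ∀ E ∈ S, E ⊆ D := by
  simp [flagsWithTop]

theorem flagsWithTop_disjoint {c : ℕ} {D E : Finset ι} (h : D ≠ E) :
    Disjoint (flagsWithTop c D) (flagsWithTop c E) := by
  rw [Finset.disjoint_left]
  intro S hS hS'
  rw [mem_flagsWithTop] at hS hS'
  exact h ((hS'.2.2.2 D hS.2.2.1).antisymm (hS.2.2.2 E hS'.2.2.1))

/-- The image of a flag and the image of its top normal determine each other: `HasChamber.index_eq`
recovers the top normal, and `HasChamber.fixes_of_subset` the rest. -/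
theorem ncard_normalSets (hW : HasChamber Δ W) (hΔ : IsObtuse Δ δ) {c : ℕ} {D : Finset ι}
    {S : Finset (Finset ι)} (hS : S ∈ flagsWithTop c D) :
    (normalSet Δ δ S '' W).ncard = ((fun σ : V ≃ₗᵢ[ℝ] V => σ (facetNormal Δ δ D)) '' W).ncard := by
  classical
  rw [mem_flagsWithTop] at hS
  obtain ⟨hflag, -, hDS, htop⟩ := hS
  refine ncard_image_eq_ncard_image fun σ hσ τ hτ => ⟨fun h => ?_, fun h => ?_⟩
  · have h1 : σ (facetNormal Δ δ D) ∈ normalSet Δ δ S τ := h ▸ Finset.mem_image_of_mem _ hDS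
    obtain ⟨E, -, hE⟩ := Finset.mem_image.1 h1
    have := hW.index_eq hΔ hτ hσ hE
    rw [this] at hE
    exact hE.symm
  · have h1 : (τ⁻¹ * σ) (facetNormal Δ δ D) = facetNormal Δ δ D := by
      rw [LinearIsometryEquiv.coe_mul, Function.comp_apply]
      rw [h]
      exact τ.symm_apply_apply _
    refine Finset.image_congr fun E hE => ?_
    have h2 := hW.fixes_of_subset hΔ (htop E hE) (W.mul_mem (W.inv_mem hτ) hσ) h1
    have h3 := congrArg τ h2
    rw [LinearIsometryEquiv.coe_mul, Function.comp_apply] at h3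
    exact (τ.apply_symm_apply _).symm.trans h3

theorem ncard_facesOfCodim_eq_sum [Nonempty ι] (hW : HasChamber Δ W) (hΔ : IsObtuse Δ δ)
    (ε : ℕ → ℝ) (hε : IsGapped (fun I i => Δ.repr (rhoPart Δ δ I) i) ε) (k : ℕ) :
    (facesOfCodim (flagPolytope Δ W δ ε) (k + 1)).ncard =
      ∑ D : Finset ι, (flagsWithTop (k + 1) D).card *
        ((fun σ : V ≃ₗᵢ[ℝ] V => σ (facetNormal Δ δ D)) '' W).ncard := by
  classical
  rw [ncard_facesOfCodim_flagPolytope hW hΔ ε hε]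
  have hset : {T | ∃ S, (IsFlag S ∧ S.card = k + 1) ∧ ∃ σ ∈ W, normalSet Δ δ S σ = T} =
      ⋃ S ∈ (Finset.univ.biUnion fun D : Finset ι => flagsWithTop (k + 1) D),
        normalSet Δ δ S '' W := by
    ext T
    simp only [Set.mem_ofPred_eq, Set.mem_iUnion, Set.mem_image, exists_prop, Finset.mem_biUnion,
      Finset.mem_univ, true_and, mem_flagsWithTop]
    constructor
    · rintro ⟨S, ⟨hS, hc⟩, h⟩
      obtain ⟨D, hD, htop⟩ := hS.exists_top (Finset.card_pos.1 (hc ▸ Nat.succ_pos k))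
      exact ⟨S, ⟨D, hS, hc, hD, htop⟩, h⟩
    · rintro ⟨S, ⟨D, hS, hc, -⟩, h⟩
      exact ⟨S, ⟨hS, hc⟩, h⟩
  have hset' := Set.Finite.ncard_biUnion
    (Finset.finite_toSet (Finset.univ.biUnion fun D : Finset ι => flagsWithTop (k + 1) D))
    (s := fun S => normalSet Δ δ S '' (W : Set (V ≃ₗᵢ[ℝ] V))) (fun S _ => hW.finite.image _) (by
      intro S _ S' _ hne
      rw [Function.onFun, Set.disjoint_left]
      rintro _ ⟨σ, hσ, rfl⟩ ⟨τ, hτ, h⟩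
      refine hne (Finset.Subset.antisymm (fun D hD => ?_) fun D hD => ?_)
      · have h1 : σ (facetNormal Δ δ D) ∈ normalSet Δ δ S' τ := h ▸ Finset.mem_image_of_mem _ hD
        obtain ⟨E, hE, hEq⟩ := Finset.mem_image.1 h1
        rwa [← hW.index_eq hΔ hτ hσ hEq]
      · have h1 : τ (facetNormal Δ δ D) ∈ normalSet Δ δ S σ := h ▸ Finset.mem_image_of_mem _ hD
        obtain ⟨E, hE, hEq⟩ := Finset.mem_image.1 h1
        rwa [← hW.index_eq hΔ hσ hτ hEq])
  rw [hset]
  refine hset'.trans ?_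
  rw [finsum_mem_coe_finset, Finset.sum_biUnion fun D _ E _ h => flagsWithTop_disjoint h]
  refine Finset.sum_congr rfl fun D _ => ?_
  rw [← smul_eq_mul, ← Finset.sum_const]
  exact Finset.sum_congr rfl fun S hS => ncard_normalSets hW hΔ hS

end Reflections

/-! ### A recursion for the bracket. -/

section ChainSum

open Classical in
/-- The sequences `1 < j_1 < ⋯ < j_{k+1} = l`. -/
def chainSet (k l : ℕ) : Finset (Fin (k + 1) → ℕ) :=
  (Fintype.piFinset fun _ => Finset.range (l + 1)).filter fun j =>
    StrictMono j ∧ (∀ t, 1 < j t) ∧ j (Fin.last k) = l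

theorem mem_chainSet {k l : ℕ} {j : Fin (k + 1) → ℕ} :
    j ∈ chainSet k l ↔ StrictMono j ∧ (∀ t, 1 < j t) ∧ j (Fin.last k) = l := by
  simp only [chainSet, Finset.mem_filter, Fintype.mem_piFinset, Finset.mem_range, and_iff_right_iff_imp]
  rintro ⟨h, -, rfl⟩ t
  exact Nat.lt_succ_of_le (h.monotone (Fin.le_last t))

theorem chainSum_eq (k l : ℕ) :
    chainSum k l = ∑ j ∈ chainSet k l, ∏ t : Fin k, (j t.succ - 1).choose (j t.castSucc - 1) := by
  refine Finset.sum_nbij (fun j t => (j t : ℕ)) ?_ ?_ ?_ fun _ _ => rfl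
  · intro j hj
    rw [mem_chainSet]
    exact (Finset.mem_filter.1 hj).2
  · intro j _ j' _ h
    funext t
    exact Fin.ext (congrFun h t)
  · intro j hj
    rw [Finset.mem_coe, mem_chainSet] at hj
    refine ⟨fun t => ⟨j t, ?_⟩, ?_, rfl⟩
    · rw [← hj.2.2]
      exact Nat.lt_succ_of_le (hj.1.monotone (Fin.le_last t))
    · exact Finset.mem_coe.2 (Finset.mem_filter.2 ⟨Finset.mem_univ _, hj⟩)

theorem chainSum_zero (m : ℕ) : chainSum 0 (m + 1) = if m = 0 then 0 else 1 := by
  rw [chainSum_eq]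
  simp only [Finset.univ_eq_empty, Finset.prod_empty, Finset.sum_const, smul_eq_mul, mul_one]
  split_ifs with hm
  · rw [Finset.card_eq_zero, Finset.eq_empty_iff_forall_notMem]
    intro j hj
    rw [mem_chainSet] at hj
    have := hj.2.1 (Fin.last 0)
    omega
  · rw [Finset.card_eq_one]
    refine ⟨fun _ => m + 1, ?_⟩
    ext j
    rw [mem_chainSet, Finset.mem_singleton]
    constructor
    · rintro ⟨-, -, h⟩
      funext t
      rw [Fin.fin_one_eq_zero t, ← h]
      rfl
    · rintro rfl
      exact ⟨fun a b hab => by omega, fun _ => show 1 < m + 1 by omega, rfl⟩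

theorem snoc_mem_chainSet {k i m : ℕ} {j : Fin (k + 1) → ℕ} (hj : j ∈ chainSet k (i + 1))
    (hi : i < m) : Fin.snoc (α := fun _ => ℕ) j (m + 1) ∈ chainSet (k + 1) (m + 1) := by
  rw [mem_chainSet] at hj ⊢
  refine ⟨Fin.strictMono_iff_lt_succ.2 fun t => ?_, fun t => ?_, by simp⟩
  · induction t using Fin.lastCases with
    | last => rw [Fin.snoc_castSucc, Fin.succ_last, Fin.snoc_last, hj.2.2]; omega
    | cast t =>
      rw [Fin.snoc_castSucc, Fin.succ_castSucc, Fin.snoc_castSucc]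
      exact hj.1 t.castSucc_lt_succ
  · induction t using Fin.lastCases with
    | last => rw [Fin.snoc_last]; omega
    | cast t => rw [Fin.snoc_castSucc]; exact hj.2.1 t

/-- Condition on the last entry but one, `i + 1`; its factor is `m.choose i`, and removing the final
entry leaves a shorter sequence. -/
theorem chainSum_succ (k m : ℕ) :
    chainSum (k + 1) (m + 1) = ∑ i ∈ Finset.range m, m.choose i * chainSum k (i + 1) := by
  classical
  rw [chainSum_eq]
  have hmaps : ∀ j ∈ chainSet (k + 1) (m + 1), j (Fin.last k).castSucc - 1 ∈ Finset.range m := by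
    intro j hj
    rw [mem_chainSet] at hj
    have h1 := hj.1 (Fin.castSucc_lt_last (Fin.last k))
    have h2 := hj.2.1 (Fin.last k).castSucc
    rw [hj.2.2] at h1
    rw [Finset.mem_range]
    omega
  rw [← Finset.sum_fiberwise_of_maps_to hmaps]
  refine Finset.sum_congr rfl fun i hi => ?_
  rw [Finset.mem_range] at hi
  rw [chainSum_eq, Finset.mul_sum]
  refine Finset.sum_nbij' (fun j => Fin.init j) (fun j => Fin.snoc (α := fun _ => ℕ) j (m + 1))
    ?_ ?_ ?_ ?_ ?_
  · intro j hj
    rw [Finset.mem_filter, mem_chainSet] at hj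
    obtain ⟨⟨h1, h2, h3⟩, h4⟩ := hj
    rw [mem_chainSet]
    refine ⟨fun a b hab => h1 (Fin.castSucc_lt_castSucc_iff.2 hab), fun t => h2 _, ?_⟩
    have := h2 (Fin.last k).castSucc
    simp only [Fin.init]
    omega
  · intro j hj
    rw [Finset.mem_filter]
    refine ⟨snoc_mem_chainSet hj hi, ?_⟩
    rw [mem_chainSet] at hj
    rw [Fin.snoc_castSucc, hj.2.2]
    rfl
  · intro j hj
    rw [Finset.mem_filter, mem_chainSet] at hj
    rw [← hj.1.2.2]
    exact Fin.snoc_init_self j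
  · intro j _
    exact Fin.init_snoc _ _
  · intro j hj
    rw [Finset.mem_filter, mem_chainSet] at hj
    rw [Fin.prod_univ_castSucc, mul_comm, Fin.succ_last, hj.1.2.2, hj.2]
    rfl

/-- There is no room for `k + 1` integers above 1 ending at `l`. This is why the condition on `l(λ)`
in the theorem loses no terms. -/
theorem chainSum_eq_zero {k l : ℕ} (h : l < k + 2) : chainSum k l = 0 := by
  induction k generalizing l with
  | zero =>
    rw [chainSum_eq]
    refine Finset.sum_eq_zero fun j hj => ?_
    rw [mem_chainSet] at hj
    have := hj.2.1 (Fin.last 0)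
    omega
  | succ k ih =>
    rcases l with _ | m
    · rw [chainSum_eq]
      refine Finset.sum_eq_zero fun j hj => ?_
      rw [mem_chainSet] at hj
      have := hj.2.1 (Fin.last _)
      omega
    · rw [chainSum_succ]
      refine Finset.sum_eq_zero fun i hi => ?_
      rw [Finset.mem_range] at hi
      rw [ih (by omega), mul_zero]

end ChainSum

/-! ### Counting flags with a given top. -/

section FlagCount

variable {ι : Type*} [Fintype ι] [DecidableEq ι]

theorem flagsWithTop_one (D : Finset ι) :
    (flagsWithTop 1 D).card = if D.card = 0 then 0 else 1 := by
  classical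
  split_ifs with hD
  · rw [Finset.card_eq_zero, Finset.eq_empty_iff_forall_notMem]
    intro S hS
    rw [mem_flagsWithTop] at hS
    exact (hS.1.1 D hS.2.2.1).card_pos.ne' hD
  · rw [Finset.card_eq_one]
    refine ⟨{D}, ?_⟩
    ext S
    rw [mem_flagsWithTop, Finset.mem_singleton]
    constructor
    · rintro ⟨-, h, hD, -⟩
      obtain ⟨E, rfl⟩ := Finset.card_eq_one.1 h
      rw [Finset.mem_singleton.1 hD]
    · rintro rfl
      refine ⟨⟨?_, ?_⟩, Finset.card_singleton D, Finset.mem_singleton_self D, ?_⟩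
      · simpa [← Finset.card_pos, Nat.pos_iff_ne_zero] using hD
      · simp
      · simp

/-- Deleting `D` leaves a nonempty flag, whose own top `E` is a proper subset of `D`. -/
theorem card_flagsWithTop_succ (k : ℕ) (D : Finset ι) :
    (flagsWithTop (k + 2) D).card = ∑ E ∈ D.ssubsets, (flagsWithTop (k + 1) E).card := by
  classical
  rw [← Finset.card_biUnion fun E _ F _ h => flagsWithTop_disjoint h]
  refine Finset.card_bij' (fun S _ => S.erase D) (fun S _ => insert D S) ?_ ?_ ?_ ?_
  · intro S hS
    rw [mem_flagsWithTop] at hS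
    obtain ⟨hS, hc, hD, htop⟩ := hS
    have hc' : (S.erase D).card = k + 1 := by rw [Finset.card_erase_of_mem hD, hc]; rfl
    have hflag := hS.mono (S.erase_subset D)
    obtain ⟨E, hE, hEtop⟩ := hflag.exists_top (Finset.card_pos.1 (hc' ▸ Nat.succ_pos k))
    rw [Finset.mem_biUnion]
    refine ⟨E, ?_, mem_flagsWithTop.2 ⟨hflag, hc', hE, hEtop⟩⟩
    rw [Finset.mem_erase] at hE
    exact Finset.mem_ssubsets.2 (Finset.ssubset_iff_subset_ne.2 ⟨htop E hE.2, hE.1⟩)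
  · intro S hS
    rw [Finset.mem_biUnion] at hS
    obtain ⟨E, hE, hS⟩ := hS
    rw [Finset.mem_ssubsets] at hE
    rw [mem_flagsWithTop] at hS
    obtain ⟨hS, hc, hES, htop⟩ := hS
    have hsub : ∀ F ∈ S, F ⊆ D := fun F hF => (htop F hF).trans hE.subset
    have hDS : D ∉ S := fun h => hE.not_subset (htop D h)
    rw [mem_flagsWithTop]
    refine ⟨hS.insert ((hS.1 E hES).mono hE.subset) hsub, ?_, Finset.mem_insert_self _ _, ?_⟩
    · rw [Finset.card_insert_of_notMem hDS, hc]
    · intro F hF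
      rcases Finset.mem_insert.1 hF with rfl | hF
      exacts [subset_rfl, hsub F hF]
  · intro S hS
    rw [mem_flagsWithTop] at hS
    exact Finset.insert_erase hS.2.2.1
  · intro S hS
    rw [Finset.mem_biUnion] at hS
    obtain ⟨E, hE, hS⟩ := hS
    rw [mem_flagsWithTop] at hS
    exact Finset.erase_insert fun h => (Finset.mem_ssubsets.1 hE).not_subset (hS.2.2.2 D h)

/-- Grouping the second largest members by size turns the recursion for flags into `chainSum_succ`;
sizes are shifted by one, so `1 < j_1` means that the smallest member is nonempty. -/
theorem card_flagsWithTop (k : ℕ) (D : Finset ι) :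
    (flagsWithTop (k + 1) D).card = chainSum k (D.card + 1) := by
  induction k generalizing D with
  | zero => rw [flagsWithTop_one, chainSum_zero]
  | succ k ih =>
    rw [card_flagsWithTop_succ, chainSum_succ]
    simp only [ih]
    have hmaps : ∀ E ∈ D.ssubsets, E.card ∈ Finset.range D.card := fun E hE =>
      Finset.mem_range.2 (Finset.card_lt_card (Finset.mem_ssubsets.1 hE))
    rw [← Finset.sum_fiberwise_of_maps_to hmaps]
    refine Finset.sum_congr rfl fun i hi => ?_
    have hfib : {E ∈ D.ssubsets | E.card = i} = D.powersetCard i := by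
      ext E
      rw [Finset.mem_filter, Finset.mem_ssubsets, Finset.mem_powersetCard]
      refine and_congr_left fun hE => ⟨fun h => h.subset, fun h => ?_⟩
      refine Finset.ssubset_iff_subset_ne.2 ⟨h, fun hED => ?_⟩
      rw [Finset.mem_range, ← hE, hED] at hi
      exact hi.false
    rw [hfib, ← Finset.card_powersetCard, ← smul_eq_mul, ← Finset.sum_const]
    refine Finset.sum_congr rfl fun E hE => ?_
    rw [(Finset.mem_powersetCard.1 hE).2]

end FlagCount

/-! ### Rearrangements of a function. -/

section FunctionOrbits

/-- Orbit-stabilizer; composition on the right is an action of the group `DomMulAct`. -/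
theorem ncard_range_comp_perm_mul {α β : Type*} [Fintype α] [DecidableEq α] [DecidableEq β]
    (f : α → β) :
    (Set.range fun σ : Equiv.Perm α => f ∘ σ).ncard *
      Fintype.card {σ : Equiv.Perm α // f ∘ σ = f} = (Fintype.card α).factorial := by
  classical
  have hfin : Finite (Equiv.Perm α)ᵈᵐᵃ := Finite.of_equiv _ DomMulAct.mk
  have hrange : (Set.range fun σ : Equiv.Perm α => f ∘ σ) =
      MulAction.orbit (Equiv.Perm α)ᵈᵐᵃ f := by
    ext g
    constructor
    · rintro ⟨σ, rfl⟩
      exact ⟨DomMulAct.mk σ, rfl⟩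
    · rintro ⟨σ, rfl⟩
      exact ⟨DomMulAct.mk.symm σ, rfl⟩
  have hstab : Fintype.card {σ : Equiv.Perm α // f ∘ σ = f} =
      Nat.card (MulAction.stabilizer (Equiv.Perm α)ᵈᵐᵃ f) := by
    rw [← Nat.card_eq_fintype_card]
    exact Nat.card_congr (DomMulAct.mk.subtypeEquiv fun _ => Iff.rfl)
  rw [hrange, hstab, ← Nat.card_coe_set_eq, ← Nat.card_prod,
    Nat.card_congr (MulAction.orbitProdStabilizerEquivGroup (Equiv.Perm α)ᵈᵐᵃ f),
    Nat.card_congr DomMulAct.mk.symm, Nat.card_perm, Nat.card_eq_fintype_card]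

theorem exists_perm_of_ofFn_perm {m : ℕ} {f g : Fin m → ℕ}
    (h : (List.ofFn f).Perm (List.ofFn g)) : ∃ σ : Equiv.Perm (Fin m), f ∘ σ = g := by
  have hsort : f ∘ Tuple.sort f = g ∘ Tuple.sort g := by
    refine List.ofFn_injective (List.Perm.eq_of_pairwise' (r := (· ≤ ·)) ?_ ?_ ?_)
    · exact (Tuple.monotone_sort f).sortedLE_ofFn.pairwise
    · exact (Tuple.monotone_sort g).sortedLE_ofFn.pairwise
    · exact ((Tuple.sort f).ofFn_comp_perm f).trans (h.trans ((Tuple.sort g).ofFn_comp_perm g).symm)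
  refine ⟨(Tuple.sort g).symm.trans (Tuple.sort f), ?_⟩
  funext i
  have := congrFun hsort ((Tuple.sort g).symm i)
  simpa using this

theorem card_fiber_eq_count {m : ℕ} (f : Fin m → ℕ) (i : ℕ) :
    Fintype.card {a // f a = i} = (List.ofFn f).count i := by
  rw [← Multiset.coe_count, ← Fin.univ_val_map, Multiset.count_map, Fintype.card_subtype]
  simp only [eq_comm]
  rfl

end FunctionOrbits

/-! ### Compositions, their bars, and the partitions underlying them. -/

section Compositions

variable {n : ℕ}

/-- The compositions over `p` are the rearrangements of one block sequence, whose stabilizer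
permutes blocks of equal size. -/
theorem card_compositions_mul (p : n.Partition) :
    (Finset.univ.filter fun c : Composition n => Nat.Partition.ofComposition n c = p).card *
      ∏ i ∈ Finset.Icc 1 n, (p.parts.count i).factorial = p.parts.card.factorial := by
  classical
  obtain ⟨c₀, rfl⟩ := Nat.Partition.ofComposition_surj p
  set f := c₀.blocksFun with hf
  have hL : List.ofFn f = c₀.blocks := c₀.ofFn_blocksFun
  have hparts : (Nat.Partition.ofComposition n c₀).parts = (c₀.blocks : Multiset ℕ) := rfl
  have hcount : (Finset.univ.filter fun c : Composition n => Nat.Partition.ofComposition n c =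
      Nat.Partition.ofComposition n c₀).card =
        (Set.range fun σ : Equiv.Perm (Fin c₀.length) => f ∘ σ).ncard := by
    rw [← Set.ncard_coe_finset]
    have h1 : List.ofFn '' (Set.range fun σ : Equiv.Perm (Fin c₀.length) => f ∘ σ) =
        Composition.blocks '' ((Finset.univ.filter fun c : Composition n =>
          Nat.Partition.ofComposition n c = Nat.Partition.ofComposition n c₀ :
            Finset (Composition n)) : Set (Composition n)) := by
      ext L
      constructor
      · rintro ⟨_, ⟨σ, rfl⟩, rfl⟩
        have hperm : (List.ofFn (f ∘ σ)).Perm c₀.blocks := hL ▸ σ.ofFn_comp_perm f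
        refine ⟨⟨List.ofFn (f ∘ σ), fun {i} hi => c₀.blocks_pos (hperm.mem_iff.1 hi),
          hperm.sum_eq.trans c₀.blocks_sum⟩, ?_, rfl⟩
        rw [Finset.mem_coe, Finset.mem_filter]
        exact ⟨Finset.mem_univ _, Nat.Partition.ext (Multiset.coe_eq_coe.2 hperm)⟩
      · rintro ⟨c, hc, rfl⟩
        rw [Finset.mem_coe, Finset.mem_filter] at hc
        have hperm : c₀.blocks.Perm c.blocks :=
          Multiset.coe_eq_coe.1 (congrArg Nat.Partition.parts hc.2).symm
        have hlen : c.blocks.length = c₀.length := hperm.length_eq.symm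
        have hget : List.ofFn (fun i : Fin c₀.length => c.blocks.get (i.cast hlen.symm)) =
            c.blocks := by
          rw [← List.ofFn_congr hlen c.blocks.get, List.ofFn_get]
        rw [← hL, ← hget] at hperm
        obtain ⟨σ, hσ⟩ := exists_perm_of_ofFn_perm hperm
        exact ⟨_, ⟨σ, hσ⟩, hget⟩
    rw [← List.ofFn_injective.injOn.ncard_image, h1, Set.InjOn.ncard_image]
    exact fun c _ c' _ h => Composition.ext h
  have hstab : Fintype.card {σ : Equiv.Perm (Fin c₀.length) // f ∘ σ = f} =
      ∏ i ∈ Finset.Icc 1 n, ((Nat.Partition.ofComposition n c₀).parts.count i).factorial := by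
    rw [DomMulAct.stabilizer_card']
    simp only [card_fiber_eq_count, hL, hparts, Multiset.coe_count]
    refine Finset.prod_subset (fun i hi => ?_) fun i _ hi => ?_
    · obtain ⟨a, -, rfl⟩ := Finset.mem_image.1 hi
      exact Finset.mem_Icc.2 ⟨c₀.one_le_blocksFun a, c₀.blocksFun_le a⟩
    · rw [List.count_eq_zero_of_not_mem, Nat.factorial_zero]
      intro hmem
      rw [← hL, List.mem_ofFn] at hmem
      obtain ⟨a, ha⟩ := hmem
      exact hi (Finset.mem_image.2 ⟨a, Finset.mem_univ a, ha⟩)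
  rw [hcount, ← hstab, ncard_range_comp_perm_mul, Fintype.card_fin]
  rfl

theorem card_index_fiber (c : Composition n) (i : Fin c.length) :
    Fintype.card {a // c.index a = i} = c.blocksFun i := by
  have h : Set.range (c.embedding i) = {a | c.index a = i} := by
    ext a
    rw [Composition.mem_range_embedding_iff', eq_comm]
    rfl
  rw [← Nat.card_eq_fintype_card, ← Nat.card_fin (c.blocksFun i)]
  exact (Nat.card_congr ((Equiv.ofInjective _ (c.embedding i).injective).trans
    (Equiv.setCongr h))).symm

theorem card_stabilizer_index (c : Composition n) :
    Fintype.card {σ : Equiv.Perm (Fin n) // c.index ∘ σ = c.index} =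
      (c.blocks.map Nat.factorial).prod := by
  rw [DomMulAct.stabilizer_card]
  simp only [card_index_fiber]
  rw [← List.prod_ofFn, ← c.ofFn_blocksFun, List.map_ofFn]
  rfl

/-- The positions `i` such that `i` and `i + 1` are in different blocks of the composition. -/
def bars (n : ℕ) : Composition n ≃ Finset (Fin (n - 1)) :=
  (compositionEquiv n).trans (compositionAsSetEquiv n)

theorem mem_bars {c : Composition n} {i : Fin (n - 1)} :
    i ∈ bars n c ↔ ∃ j, j ≤ c.length ∧ c.sizeUpTo j = i + 1 := by
  have h1 : i ∈ bars n c ↔ (⟨1 + (i : ℕ), by omega⟩ : Fin n.succ) ∈ c.boundaries := by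
    simp only [bars, compositionAsSetEquiv, Equiv.trans_apply, Equiv.coe_fn_mk, Set.mem_toFinset]
    rfl
  rw [h1]
  simp only [Composition.boundaries, Finset.mem_map, Finset.mem_univ, true_and]
  constructor
  · rintro ⟨j, hj⟩
    refine ⟨j, Nat.lt_succ_iff.1 j.2, ?_⟩
    exact (congrArg Fin.val hj).trans (add_comm _ _)
  · rintro ⟨j, hj, h⟩
    refine ⟨⟨j, Nat.lt_succ_of_le hj⟩, Fin.ext ?_⟩
    rw [add_comm] at h
    exact h

theorem index_eq_iff {c : Composition n} {p q : Fin n} (hpq : p < q) :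
    c.index p = c.index q ↔ ∀ i ∈ bars n c, ¬ ((p : ℕ) ≤ i ∧ (i : ℕ) < q) := by
  have hp : (p : ℕ) < c.sizeUpTo ((c.index p : ℕ) + 1) := c.lt_sizeUpTo_index_succ p
  have hp' := c.sizeUpTo_index_le p
  have hq : (q : ℕ) < c.sizeUpTo ((c.index q : ℕ) + 1) := c.lt_sizeUpTo_index_succ q
  have hq' := c.sizeUpTo_index_le q
  constructor
  · rintro h i hi ⟨h1, h2⟩
    obtain ⟨j, -, hj⟩ := mem_bars.1 hi
    rw [← h] at hq hq'
    rcases le_or_gt j (c.index p) with hle | hlt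
    · have := c.monotone_sizeUpTo hle
      omega
    · have : c.sizeUpTo ((c.index p : ℕ) + 1) ≤ c.sizeUpTo j :=
        c.monotone_sizeUpTo (Nat.succ_le_of_lt hlt)
      omega
  · intro h
    by_contra hne
    have hlt : (c.index p : ℕ) < c.index q := by
      rcases lt_or_gt_of_ne (Fin.val_ne_of_ne hne) with h1 | h1
      · exact h1
      · have : c.sizeUpTo ((c.index q : ℕ) + 1) ≤ c.sizeUpTo (c.index p) :=
          c.monotone_sizeUpTo (Nat.succ_le_of_lt h1)
        have : (p : ℕ) < q := hpq
        omega
    have h1 : c.sizeUpTo ((c.index p : ℕ) + 1) ≤ c.sizeUpTo (c.index q) :=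
      c.monotone_sizeUpTo (Nat.succ_le_of_lt hlt)
    have h2 := q.2
    -- The bar just before the block of `q`; bar `i` separates positions `i` and `i + 1`, whence the
    -- `- 1`.
    refine h ⟨c.sizeUpTo (c.index q) - 1, by omega⟩ (mem_bars.2 ⟨c.index q, (c.index q).2.le, ?_⟩) ?_
    · simp only
      omega
    · simp only
      omega

/-- Bars are the boundaries other than the endpoints `0` and `n`, which are distinct because `n >
0`. -/
theorem card_bars (hn : 0 < n) (c : Composition n) : (bars n c).card + 1 = c.length := by
  classical
  have h0 : (0 : Fin (n + 1)) ∈ c.boundaries := c.toCompositionAsSet.zero_mem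
  have hl : Fin.last n ∈ c.boundaries := c.toCompositionAsSet.getLast_mem
  have hne : Fin.last n ≠ 0 := by
    rw [Ne, Fin.ext_iff]
    exact hn.ne'
  have h2 : (bars n c).card = ((c.boundaries.erase 0).erase (Fin.last n)).card := by
    refine Finset.card_bij (fun i _ => ⟨i + 1, by omega⟩) ?_ ?_ ?_
    · intro i hi
      obtain ⟨j, hj, h⟩ := mem_bars.1 hi
      refine Finset.mem_erase.2 ⟨?_, Finset.mem_erase.2 ⟨?_, ?_⟩⟩
      · rw [Ne, Fin.ext_iff]
        simp only [Fin.val_last]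
        omega
      · rw [Ne, Fin.ext_iff]
        simp
      · exact Finset.mem_map.2 ⟨⟨j, Nat.lt_succ_of_le hj⟩, Finset.mem_univ _, Fin.ext h⟩
    · intro i _ j _ h
      rw [Fin.ext_iff] at h ⊢
      simpa using h
    · intro b hb
      rw [Finset.mem_erase, Finset.mem_erase] at hb
      obtain ⟨hb1, hb2, hb3⟩ := hb
      obtain ⟨j, -, hj⟩ := Finset.mem_map.1 hb3
      rw [Ne, Fin.ext_iff, Fin.val_last] at hb1
      rw [Ne, Fin.ext_iff, Fin.val_zero] at hb2
      refine ⟨⟨b - 1, by omega⟩, mem_bars.2 ⟨j, Nat.lt_succ_iff.1 j.2, ?_⟩, Fin.ext ?_⟩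
      · have := congrArg Fin.val hj
        change c.sizeUpTo j = b at this
        simp only
        omega
      · simp only
        omega
  rw [h2, Finset.card_erase_of_mem (Finset.mem_erase.2 ⟨hne, hl⟩), Finset.card_erase_of_mem h0,
    c.card_boundaries_eq_succ_length]
  have := c.length_pos_iff.2 hn
  omega

theorem sum_eq_sum_partition (hn : 0 < n) (k : ℕ) (N : Finset (Fin (n - 1)) → ℕ)
    (hN : ∀ c : Composition n,
      N (bars n c) * (c.blocks.map Nat.factorial).prod = n.factorial) :
    ((∑ D : Finset (Fin (n - 1)), chainSum k (D.card + 1) * N D : ℕ) : ℚ) =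
      ∑ p : n.Partition with k + 2 ≤ p.parts.card,
        partitionWeight p * partitionMultinomial p * (chainSum k p.parts.card : ℚ) := by
  classical
  have hmul : ∀ c : Composition n, (N (bars n c) : ℚ) =
      partitionMultinomial (Nat.Partition.ofComposition n c) := by
    intro c
    have h1 : ((Nat.Partition.ofComposition n c).parts.map fun m => (m.factorial : ℚ)).prod =
        ((c.blocks.map Nat.factorial).prod : ℕ) := by
      rw [Nat.cast_list_prod, List.map_map]
      rfl
    rw [partitionMultinomial, h1, eq_div_iff, ← Nat.cast_mul, hN]
    intro h0
    have := hN c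
    rw [Nat.cast_eq_zero.1 h0, mul_zero] at this
    exact n.factorial_ne_zero this.symm
  have hw : ∀ p : n.Partition, partitionWeight p =
      ((Finset.univ.filter fun c : Composition n => Nat.Partition.ofComposition n c = p).card : ℚ) := by
    intro p
    rw [partitionWeight, div_eq_iff, ← card_compositions_mul p, Nat.cast_mul, Nat.cast_prod]
    exact Finset.prod_ne_zero_iff.2 fun i _ => Nat.cast_ne_zero.2 (Nat.factorial_ne_zero _)
  rw [← (bars n).sum_comp]
  simp only [card_bars hn]
  rw [Finset.sum_filter_of_ne, Nat.cast_sum, ← Finset.sum_fiberwise_of_maps_to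
    (s := Finset.univ) (t := Finset.univ) (g := Nat.Partition.ofComposition n) (by simp)]
  · refine Finset.sum_congr rfl fun p _ => ?_
    rw [hw, mul_assoc, ← nsmul_eq_mul, ← Finset.sum_const]
    refine Finset.sum_congr rfl fun c hc => ?_
    rw [← (Finset.mem_filter.1 hc).2, ← hmul, Nat.cast_mul, mul_comm]
    rfl
  · intro p _ hp
    by_contra hlt
    rw [chainSum_eq_zero (not_le.1 hlt)] at hp
    simp at hp

end Compositions

/-! ### The maximal building set and suitable lists. -/

section Maximal

variable {V : Type*} [NormedAddCommGroup V] [InnerProductSpace ℝ V] [FiniteDimensional ℝ V]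
variable {ι : Type*} [Fintype ι] [DecidableEq ι]

theorem finrank_simpleSpan (Δ : Basis ι ℝ V) (I : Finset ι) :
    finrank ℝ (simpleSpan Δ I) = I.card := by
  classical
  have h := finrank_span_finset_eq_card (R := ℝ) (s := I.image Δ) (by
    rw [Finset.coe_image]
    exact (Δ.linearIndependent.linearIndepOn (s := (I : Set ι))).id_image)
  rw [Finset.card_image_of_injective _ Δ.injective, Finset.coe_image] at h
  exact h

theorem mem_simpleSpan_iff (Δ : Basis ι ℝ V) {I : Finset ι} {i : ι} :
    Δ i ∈ simpleSpan Δ I ↔ i ∈ I := by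
  refine ⟨fun h => ?_, fun h => subset_span ⟨i, h, rfl⟩⟩
  by_contra hi
  rw [simpleSpan, Basis.mem_span_image, Δ.repr_self] at h
  exact hi (h (Finsupp.mem_support_iff.2 (by simp)))

theorem simpleSpan_eq_top_iff (Δ : Basis ι ℝ V) {I : Finset ι} :
    simpleSpan Δ I = ⊤ ↔ I = Finset.univ := by
  constructor
  · intro h
    ext i
    rw [← mem_simpleSpan_iff Δ, h]
    simp
  · rintro rfl
    simp [simpleSpan, Δ.span_eq]

theorem mem_fund_maximal_iff {Φ : Finset V} {Δ : Basis ι ℝ V} (hΔ : ∀ i, Δ i ∈ Φ)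
    (h0 : (0 : V) ∉ Φ) {A : Submodule ℝ V} :
    A ∈ fund Δ (maximalBuildingSet Φ) ↔ ∃ I : Finset ι, I.Nonempty ∧ A = simpleSpan Δ I := by
  classical
  constructor
  · rintro ⟨⟨S, hS, ⟨β, hβ⟩, hA⟩, I, rfl⟩
    refine ⟨I.toFinite.toFinset, ?_, by simp [simpleSpan]⟩
    rw [Set.Finite.toFinset_nonempty, Set.nonempty_iff_ne_empty]
    rintro rfl
    have : β ∈ span ℝ S := subset_span hβ
    rw [← hA, Set.image_empty, span_empty, mem_bot] at this
    exact h0 (this ▸ hS hβ)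
  · rintro ⟨I, ⟨i, hi⟩, rfl⟩
    refine ⟨⟨Δ '' I, ?_, ⟨Δ i, i, hi, rfl⟩, rfl⟩, I, rfl⟩
    rintro _ ⟨j, -, rfl⟩
    exact hΔ j

theorem mem_image_halfSpace_iff (Φ : Finset V) (Δ : Basis ι ℝ V) (ε : ℕ → ℝ) (σ : V ≃ₗᵢ[ℝ] V)
    {I : Finset ι} (hI : I.Nonempty) (x : V) : x ∈ σ '' halfSpace Φ Δ ε (simpleSpan Δ I) ↔
      inner ℝ x (σ (facetNormal Δ (delta Φ Δ) (if I = Finset.univ then Finset.univ else Iᶜ))) ≤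
        facetBound ι ε (if I = Finset.univ then Finset.univ else Iᶜ) := by
  have hx : x ∈ σ '' halfSpace Φ Δ ε (simpleSpan Δ I) ↔
      σ.symm x ∈ halfSpace Φ Δ ε (simpleSpan Δ I) := by
    constructor
    · rintro ⟨y, hy, rfl⟩
      rwa [σ.symm_apply_apply]
    · exact fun h => ⟨_, h, σ.apply_symm_apply x⟩
  have hin : ∀ u, inner ℝ (σ.symm x) u = inner ℝ x (σ u) := fun u => by
    rw [← σ.inner_map_map, σ.apply_symm_apply]
  rw [hx, halfSpace, Set.mem_ofPred_eq, hin, deltaVec, finrank_simpleSpan, finrank_eq_card_basis Δ,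
    facetBound]
  by_cases hu : I = Finset.univ
  · rw [if_pos ((simpleSpan_eq_top_iff Δ).2 hu), if_pos ((simpleSpan_eq_top_iff Δ).2 hu),
      if_pos hu, if_pos rfl, facetNormal, Finset.compl_univ, rhoPart_empty, sub_zero]
  · have hI' : Iᶜ ≠ Finset.univ := by
      rw [Ne, Finset.compl_eq_univ_iff]
      exact hI.ne_empty
    rw [if_neg (mt (simpleSpan_eq_top_iff Δ).1 hu), if_neg (mt (simpleSpan_eq_top_iff Δ).1 hu),
      if_neg hu, facetNormal, compl_compl, if_neg hI']
    rfl

/-- For the maximal building set the second family of half-spaces is empty. Complements of proper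
nonempty sets are again such sets, and the half-space of `V` supplies `D = univ`. -/
theorem permutonestohedron_maximal_eq {Φ : Finset V} {Δ : Basis ι ℝ V} (hΔ : ∀ i, Δ i ∈ Φ)
    (h0 : (0 : V) ∉ Φ) [Nonempty ι] (ε : ℕ → ℝ) :
    permutonestohedron Φ Δ (maximalBuildingSet Φ) ε =
      flagPolytope Δ (weylGroup Φ) (delta Φ Δ) ε := by
  ext x
  simp only [permutonestohedron, Set.sdiff_self, Set.mem_inter_iff, Set.mem_iInter, flagPolytope,
    Set.mem_ofPred_eq, Set.mem_empty_iff_false, false_implies, implies_true, and_true]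
  constructor
  · intro h σ hσ D hD
    by_cases hDu : D = Finset.univ
    · have := h σ hσ (simpleSpan Δ Finset.univ)
        ((mem_fund_maximal_iff hΔ h0).2 ⟨_, Finset.univ_nonempty, rfl⟩)
      rw [mem_image_halfSpace_iff _ _ _ _ Finset.univ_nonempty, if_pos rfl] at this
      rwa [hDu]
    · have hDc : Dᶜ.Nonempty := by
        rw [Finset.nonempty_iff_ne_empty, Ne, Finset.compl_eq_empty_iff]; exact hDu
      have := h σ hσ (simpleSpan Δ Dᶜ) ((mem_fund_maximal_iff hΔ h0).2 ⟨_, hDc, rfl⟩)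
      rwa [mem_image_halfSpace_iff _ _ _ _ hDc, if_neg (by
        rw [Finset.compl_eq_univ_iff]; exact hD.ne_empty), compl_compl] at this
  · intro h σ hσ A hA
    obtain ⟨I, hI, rfl⟩ := (mem_fund_maximal_iff hΔ h0).1 hA
    rw [mem_image_halfSpace_iff _ _ _ _ hI]
    refine h σ hσ _ ?_
    split_ifs with hu
    · exact Finset.univ_nonempty
    · rw [Finset.nonempty_iff_ne_empty, Ne, Finset.compl_eq_empty_iff]
      exact hu

theorem ratio_simpleSpan_ge {Φ : Finset V} {Δ : Basis ι ℝ V} (hO : IsObtuse Δ (delta Φ Δ))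
    {I J : Finset ι} {i : ι} (hI : i ∈ I) (hJ : i ∈ J) :
    Δ.repr (rhoPart Δ (delta Φ Δ) J) i ≤
      ratio Φ Δ (simpleSpan Δ J) (simpleSpan Δ I) * Δ.repr (rhoPart Δ (delta Φ Δ) I) i := by
  have hI' : Δ i ∈ simpleSpan Δ I := (mem_simpleSpan_iff Δ).2 hI
  have hJ' : Δ i ∈ simpleSpan Δ J := (mem_simpleSpan_iff Δ).2 hJ
  have hsup : Δ.repr (rhoPart Δ (delta Φ Δ) J) i ≤
      ⨆ j : {j : ι // Δ j ∈ simpleSpan Δ J}, Δ.repr (piVec Φ Δ (simpleSpan Δ J)) j :=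
    le_ciSup (f := fun j : {j : ι // Δ j ∈ simpleSpan Δ J} =>
      Δ.repr (piVec Φ Δ (simpleSpan Δ J)) j) (Set.finite_range _).bddAbove ⟨i, hJ'⟩
  have hinf : (⨅ j : {j : ι // Δ j ∈ simpleSpan Δ I}, Δ.repr (piVec Φ Δ (simpleSpan Δ I)) j) ≤
      Δ.repr (rhoPart Δ (delta Φ Δ) I) i :=
    ciInf_le (f := fun j : {j : ι // Δ j ∈ simpleSpan Δ I} =>
      Δ.repr (piVec Φ Δ (simpleSpan Δ I)) j) (Set.finite_range _).bddBelow ⟨i, hI'⟩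
  have hne : Nonempty {j : ι // Δ j ∈ simpleSpan Δ I} := ⟨⟨i, hI'⟩⟩
  have hinfpos : 0 < ⨅ j : {j : ι // Δ j ∈ simpleSpan Δ I},
      Δ.repr (piVec Φ Δ (simpleSpan Δ I)) j := by
    obtain ⟨j, hj⟩ := exists_eq_ciInf_of_finite (f := fun j : {j : ι // Δ j ∈ simpleSpan Δ I} =>
      Δ.repr (piVec Φ Δ (simpleSpan Δ I)) j)
    rw [← hj]
    exact repr_rhoPart_pos hO ((mem_simpleSpan_iff Δ).1 j.2)
  have hJpos := repr_rhoPart_pos hO hJ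
  rw [ratio, div_mul_eq_mul_div, le_div_iff₀ hinfpos]
  exact mul_le_mul hsup hinf hinfpos.le (hJpos.le.trans hsup)

theorem ratio_le_maxRatio {Φ : Finset V} {Δ : Basis ι ℝ V} (hΔ : ∀ i, Δ i ∈ Φ)
    (h0 : (0 : V) ∉ Φ) {I J : Finset ι} (hI : I.Nonempty) (hIJ : I ⊂ J) :
    ratio Φ Δ (simpleSpan Δ J) (simpleSpan Δ I) ≤
      maxRatio Φ Δ (maximalBuildingSet Φ) J.card I.card := by
  refine le_csSup ?_ ⟨simpleSpan Δ J, (mem_fund_maximal_iff hΔ h0).2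
    ⟨J, hI.mono hIJ.subset, rfl⟩, simpleSpan Δ I, (mem_fund_maximal_iff hΔ h0).2 ⟨I, hI, rfl⟩, ?_,
    finrank_simpleSpan Δ J, finrank_simpleSpan Δ I, rfl⟩
  -- Boundedness matters here: `sSup` of an unbounded set of reals would be 0.
  · refine Set.Finite.bddAbove ((Set.finite_range fun p : Finset ι × Finset ι =>
      ratio Φ Δ (simpleSpan Δ p.1) (simpleSpan Δ p.2)).subset ?_)
    rintro r ⟨A, hA, B, hB, -, -, -, rfl⟩
    obtain ⟨K, -, rfl⟩ := (mem_fund_maximal_iff hΔ h0).1 hA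
    obtain ⟨L, -, rfl⟩ := (mem_fund_maximal_iff hΔ h0).1 hB
    exact ⟨(K, L), rfl⟩
  · refine lt_of_le_of_ne (span_mono (Set.image_mono hIJ.subset)) fun h => ?_
    obtain ⟨i, hiJ, hiI⟩ := Finset.exists_of_ssubset hIJ
    exact hiI ((mem_simpleSpan_iff Δ).1 (h ▸ (mem_simpleSpan_iff Δ).2 hiJ))

/-- Each quotient of coefficients at a common simple root is at most maximum over minimum, hence at
most `maxRatio`. -/
theorem IsSuitableList.isGapped {Φ : Finset V} {Δ : Basis ι ℝ V} (hΔ : ∀ i, Δ i ∈ Φ)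
    (h0 : (0 : V) ∉ Φ) (hO : IsObtuse Δ (delta Φ Δ)) {ε : ℕ → ℝ}
    (hε : IsSuitableList Φ Δ (maximalBuildingSet Φ) ε) :
    IsGapped (fun I i => Δ.repr (rhoPart Δ (delta Φ Δ) I) i) ε := by
  have hdim := finrank_eq_card_basis Δ
  have hpos : ∀ I : Finset ι, I.Nonempty → 0 < ε I.card := fun I hI =>
    hε.pos _ hI.card_pos (hdim ▸ I.card_le_univ)
  refine ⟨fun I i hi => repr_rhoPart_pos hO hi, hpos, fun I a i ha hi => ?_⟩
  have hIne : I.Nonempty := ⟨i, hi⟩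
  have hcard : (insert a I).card = I.card + 1 := Finset.card_insert_of_notMem ha
  have h1 := ratio_simpleSpan_ge hO hi (Finset.mem_insert_of_mem hi : i ∈ insert a I)
  have h2 := ratio_le_maxRatio hΔ h0 hIne (Finset.ssubset_insert ha)
  have h3 := hε.gap (I.card + 1) (Nat.succ_le_succ hIne.card_pos)
    (hcard ▸ hdim ▸ (insert a I).card_le_univ)
  rw [Nat.add_sub_cancel] at h3
  rw [hcard] at h2
  have hc := repr_rhoPart_pos hO hi
  have he := hpos I hIne
  calc _ ≤ 2 * (maxRatio Φ Δ (maximalBuildingSet Φ) (I.card + 1) I.card *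
        Δ.repr (rhoPart Δ (delta Φ Δ) I) i) * ε I.card := by
        have := h1.trans (mul_le_mul_of_nonneg_right h2 hc.le)
        gcongr
    _ = Δ.repr (rhoPart Δ (delta Φ Δ) I) i *
        (2 * maxRatio Φ Δ (maximalBuildingSet Φ) (I.card + 1) I.card * ε I.card) := by ring
    _ < _ := mul_lt_mul_of_pos_left h3 hc

end Maximal

theorem mem_positiveRoots {V ι : Type*} [NormedAddCommGroup V] [InnerProductSpace ℝ V]
    {Φ : Finset V} {Δ : Basis ι ℝ V} {β : V} :
    β ∈ positiveRoots Φ Δ ↔ β ∈ Φ ∧ ∀ i, 0 ≤ Δ.repr β i := by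
  classical
  exact Finset.mem_filter

/-! ### The root system of type A: positive roots, chamber, and orbits of the normals. -/

section TypeAGeometry

variable {n : ℕ}

theorem typeA_inner (x y : TypeASpace n) : inner ℝ x y = ∑ i, x.1 i * y.1 i := by
  rw [Submodule.coe_inner, PiLp.inner_apply]
  exact Finset.sum_congr rfl fun i _ => mul_comm _ _

theorem inner_typeARoot (x : TypeASpace n) (p q : Fin n) :
    inner ℝ x (typeARoot p q) = x.1 p - x.1 q := by
  rw [typeA_inner]
  simp [typeARoot, mul_sub]

theorem typeASimpleRoots_apply (i : Fin (n - 1)) :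
    typeASimpleRoots n i = typeARoot ⟨i, by omega⟩ ⟨i + 1, by omega⟩ := by
  rw [typeASimpleRoots, Basis.mk_apply, typeASimpleRoot]

theorem inner_typeASimpleRoots (x : TypeASpace n) (i : Fin (n - 1)) :
    inner ℝ x (typeASimpleRoots n i) = x.1 ⟨i, by omega⟩ - x.1 ⟨i + 1, by omega⟩ := by
  rw [typeASimpleRoots_apply, inner_typeARoot]

theorem typeARoot_apply (p q m : Fin n) :
    (typeARoot p q).1 m = (if m = p then 1 else 0) - (if m = q then 1 else 0 : ℝ) := by
  simp [typeARoot]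

theorem typeARoot_neg (p q : Fin n) : typeARoot p q = -typeARoot q p :=
  Subtype.ext (by simp [typeARoot])

theorem typeARoot_ne_zero {p q : Fin n} (h : p ≠ q) : typeARoot p q ≠ 0 := by
  intro h0
  have h1 : (typeARoot p q).1 p = 0 := by rw [h0]; rfl
  rw [typeARoot_apply, if_pos rfl, if_neg h] at h1
  norm_num at h1

theorem mem_typeARoots {β : TypeASpace n} :
    β ∈ typeARoots n ↔ ∃ p q : Fin n, p ≠ q ∧ typeARoot p q = β := by
  simp [typeARoots]

theorem typeASimpleRoots_mem (i : Fin (n - 1)) : typeASimpleRoots n i ∈ typeARoots n := by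
  rw [typeASimpleRoots_apply, mem_typeARoots]
  exact ⟨_, _, by simp [Fin.ext_iff], rfl⟩

theorem zero_notMem_typeARoots : (0 : TypeASpace n) ∉ typeARoots n := by
  rw [mem_typeARoots]
  rintro ⟨p, q, h, h0⟩
  exact typeARoot_ne_zero h h0

theorem inner_typeASimpleRoots_nonpos (i j : Fin (n - 1)) (h : i ≠ j) :
    inner ℝ (typeASimpleRoots n i) (typeASimpleRoots n j) ≤ 0 := by
  rw [Ne, Fin.ext_iff] at h
  rw [inner_typeASimpleRoots, typeASimpleRoots_apply]
  simp only [typeARoot_apply, Fin.mk.injEq]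
  split_ifs <;> first | omega | norm_num

theorem repr_typeARoot_nonneg {p q : Fin n} (h : p < q) (i : Fin (n - 1)) :
    0 ≤ (typeASimpleRoots n).repr (typeARoot p q) i := by
  obtain ⟨q, hq⟩ := q
  induction q with
  | zero => exact absurd h (Nat.not_lt_zero _)
  | succ m ih =>
    have hsplit : typeARoot p ⟨m + 1, hq⟩ =
        typeARoot p ⟨m, by omega⟩ + typeASimpleRoots n ⟨m, by omega⟩ := by
      rw [typeASimpleRoots_apply]
      exact Subtype.ext (by simp [typeARoot])
    have hs : 0 ≤ (typeASimpleRoots n).repr (typeASimpleRoots n ⟨m, by omega⟩) i := by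
      rw [Basis.repr_self, Finsupp.single_apply]
      split_ifs <;> norm_num
    rw [hsplit, map_add, Finsupp.add_apply]
    rcases (Nat.lt_succ_iff.1 h).lt_or_eq with hlt | heq
    · exact add_nonneg (ih (by omega) hlt) hs
    · have : typeARoot p ⟨m, by omega⟩ = 0 := by
        rw [show (⟨m, by omega⟩ : Fin n) = p from Fin.ext heq.symm]
        exact Subtype.ext (by simp [typeARoot])
      rw [this, map_zero, Finsupp.zero_apply, zero_add]
      exact hs

theorem typeARoot_injOn : Set.InjOn (fun p : Fin n × Fin n => typeARoot p.1 p.2)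
    {p | p.1 < p.2} := by
  rintro ⟨p, q⟩ hpq ⟨p', q'⟩ hpq' h
  simp only [Set.mem_ofPred_eq] at hpq hpq' h
  have h1 : ∀ m, (typeARoot p q).1 m = (typeARoot p' q').1 m := fun m => by rw [h]
  have hp := h1 p
  have hq := h1 q
  rw [typeARoot_apply, typeARoot_apply, if_pos rfl, if_neg hpq.ne] at hp
  rw [typeARoot_apply, typeARoot_apply, if_pos rfl, if_neg hpq.ne'] at hq
  have hp' : p = p' := by
    by_contra hne
    rw [if_neg hne] at hp
    split_ifs at hp <;> norm_num at hp
  have hq' : q = q' := by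
    by_contra hne
    rw [if_neg hne] at hq
    split_ifs at hq <;> norm_num at hq
  rw [hp', hq']

theorem positiveRoots_typeA : positiveRoots (typeARoots n) (typeASimpleRoots n) =
    (Finset.univ.filter fun p : Fin n × Fin n => p.1 < p.2).image
      fun p => typeARoot p.1 p.2 := by
  ext β
  rw [mem_positiveRoots, mem_typeARoots, Finset.mem_image]
  constructor
  · rintro ⟨⟨p, q, hpq, rfl⟩, hpos⟩
    rcases lt_or_gt_of_ne hpq with h | h
    · exact ⟨(p, q), by simpa using h, rfl⟩
    -- For `p > q` all coefficients are nonpositive; were they also nonnegative, the root would be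
    -- zero.
    · exfalso
      refine typeARoot_ne_zero hpq ((typeASimpleRoots n).repr.map_eq_zero_iff.1 ?_)
      ext i
      refine le_antisymm ?_ (hpos i)
      rw [typeARoot_neg, map_neg, Finsupp.neg_apply]
      exact neg_nonpos.2 (repr_typeARoot_nonneg h i)
  · rintro ⟨⟨p, q⟩, h, rfl⟩
    simp only [Finset.mem_filter, Finset.mem_univ, true_and] at h
    exact ⟨⟨p, q, h.ne, rfl⟩, repr_typeARoot_nonneg h⟩

theorem delta_typeA_apply (m : Fin n) :
    (delta (typeARoots n) (typeASimpleRoots n)).1 m = (n - 1 - 2 * (m : ℝ)) / 2 := by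
  have hsum : ∑ p : Fin n × Fin n with p.1 < p.2, (typeARoot p.1 p.2).1 m =
      (n - 1 - 2 * (m : ℝ)) := by
    rw [Finset.sum_filter, Fintype.sum_prod_type]
    have h1 : ∀ p q : Fin n, (if p < q then (typeARoot p q).1 m else 0) =
        (if m = p then (if p < q then 1 else 0) else 0) -
          (if m = q then (if p < q then 1 else 0) else 0 : ℝ) := by
      intro p q
      rw [typeARoot_apply]
      split_ifs <;> simp
    simp only [h1, Finset.sum_sub_distrib]
    rw [Finset.sum_comm]
    have h2 : ∀ q : Fin n, ∑ p : Fin n, (if m = p then (if p < q then 1 else 0) else 0 : ℝ) =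
        if m < q then 1 else 0 := fun q => by simp
    have h3 : ∀ p : Fin n, ∑ q : Fin n, (if m = q then (if p < q then 1 else 0) else 0 : ℝ) =
        if p < m then 1 else 0 := fun q => by simp
    simp only [h2, h3, Finset.sum_boole]
    have h4 : (Finset.univ.filter fun q : Fin n => m < q) = Finset.Ioi m := by ext; simp
    have h5 : (Finset.univ.filter fun q : Fin n => q < m) = Finset.Iio m := by ext; simp
    have h6 := m.2
    rw [h4, h5, Fin.card_Ioi, Fin.card_Iio, Nat.cast_sub (by omega), Nat.cast_sub (by omega)]
    push_cast
    ring
  rw [delta, positiveRoots_typeA, Finset.sum_image]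
  · have h6 : ((∑ p : Fin n × Fin n with p.1 < p.2, typeARoot p.1 p.2 : TypeASpace n)).1 m =
        ∑ p : Fin n × Fin n with p.1 < p.2, (typeARoot p.1 p.2).1 m := by
      rw [AddSubmonoidClass.coe_finsetSum, WithLp.ofLp_sum, Finset.sum_apply]
    rw [Submodule.coe_smul, PiLp.smul_apply, h6, hsum, smul_eq_mul]
    ring
  · intro p hp q hq h
    exact typeARoot_injOn (by simpa using hp) (by simpa using hq) h

theorem isObtuse_typeA : IsObtuse (typeASimpleRoots n)
    (delta (typeARoots n) (typeASimpleRoots n)) where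
  inner_nonpos := inner_typeASimpleRoots_nonpos
  inner_delta i := by
    rw [inner_typeASimpleRoots, delta_typeA_apply, delta_typeA_apply]
    push_cast
    ring

/-- The permutation of the coordinates by `τ`. -/
def permIsometry (τ : Equiv.Perm (Fin n)) : TypeASpace n ≃ₗᵢ[ℝ] TypeASpace n where
  toFun x := ⟨LinearIsometryEquiv.piLpCongrLeft 2 ℝ ℝ τ x.1, by
    have h : ∑ i, x.1 (τ.symm i) = 0 := (Equiv.sum_comp τ.symm x.1).trans x.2
    simpa using h⟩
  invFun x := ⟨LinearIsometryEquiv.piLpCongrLeft 2 ℝ ℝ τ.symm x.1, by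
    have h : ∑ i, x.1 (τ i) = 0 := (Equiv.sum_comp τ x.1).trans x.2
    simpa using h⟩
  left_inv x := Subtype.ext (by ext; simp)
  right_inv x := Subtype.ext (by ext; simp)
  map_add' x y := Subtype.ext (by simp)
  map_smul' c x := Subtype.ext (by simp)
  norm_map' x := LinearIsometryEquiv.norm_map (LinearIsometryEquiv.piLpCongrLeft 2 ℝ ℝ τ) x.1

theorem permIsometry_apply (τ : Equiv.Perm (Fin n)) (x : TypeASpace n) (i : Fin n) :
    (permIsometry τ x).1 i = x.1 (τ.symm i) := by
  change (LinearIsometryEquiv.piLpCongrLeft 2 ℝ ℝ τ x.1) i = _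
  simp

theorem typeA_ext {x y : TypeASpace n} (h : ∀ i, x.1 i = y.1 i) : x = y :=
  Subtype.ext (by ext i; exact h i)

/-- The action of the permutations on the coordinates. -/
def permHom (n : ℕ) : Equiv.Perm (Fin n) →* (TypeASpace n ≃ₗᵢ[ℝ] TypeASpace n) where
  toFun := permIsometry
  map_one' := by
    ext1 x
    exact typeA_ext fun i => permIsometry_apply 1 x i
  map_mul' σ τ := by
    ext1 x
    refine typeA_ext fun i => ?_
    rw [permIsometry_apply, LinearIsometryEquiv.coe_mul, Function.comp_apply, permIsometry_apply,
      permIsometry_apply]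
    rfl

theorem permHom_apply (τ : Equiv.Perm (Fin n)) (x : TypeASpace n) (i : Fin n) :
    (permHom n τ x).1 i = x.1 (τ.symm i) := permIsometry_apply τ x i

theorem reflection_typeARoot {p q : Fin n} (h : p ≠ q) :
    (ℝ ∙ typeARoot p q)ᗮ.reflection = permHom n (Equiv.swap p q) := by
  have hnorm : ‖typeARoot p q‖ ^ 2 = 2 := by
    rw [← real_inner_self_eq_norm_sq, inner_typeARoot, typeARoot_apply, typeARoot_apply,
      if_pos rfl, if_neg h, if_neg h.symm, if_pos rfl]
    norm_num
  ext1 x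
  refine typeA_ext fun i => ?_
  rw [permHom_apply, reflection_orthogonal_apply, reflection_singleton_apply, real_inner_comm,
    inner_typeARoot]
  rw [Equiv.symm_swap]
  have h2 : ((‖typeARoot p q‖ : ℝ) : ℝ) ^ 2 = 2 := hnorm
  simp only [RCLike.ofReal_real_eq_id, id_eq, h2]
  have h3 : ((-(2 • ((x.1 p - x.1 q) / 2) • typeARoot p q - x) : TypeASpace n)).1 i =
      x.1 i - (x.1 p - x.1 q) * (typeARoot p q).1 i := by
    simp
    ring
  rw [h3, typeARoot_apply, Equiv.swap_apply_def]
  split_ifs with h4 h5 h5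
  · exact absurd (h4.symm.trans h5) h
  · rw [h4]; ring
  · rw [h5]; ring
  · ring

theorem weylGroup_typeA : weylGroup (typeARoots n) = (permHom n).range := by
  have h : {s | ∃ β ∈ typeARoots n, s = (ℝ ∙ β)ᗮ.reflection} =
      permHom n '' {τ | τ.IsSwap} := by
    ext s
    constructor
    · rintro ⟨β, hβ, rfl⟩
      obtain ⟨p, q, hpq, rfl⟩ := mem_typeARoots.1 hβ
      exact ⟨Equiv.swap p q, ⟨p, q, hpq, rfl⟩, (reflection_typeARoot hpq).symm⟩
    · rintro ⟨_, ⟨p, q, hpq, rfl⟩, rfl⟩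
      exact ⟨_, mem_typeARoots.2 ⟨p, q, hpq, rfl⟩, (reflection_typeARoot hpq).symm⟩
  rw [weylGroup, h, ← MonoidHom.map_closure, Equiv.Perm.closure_isSwap, MonoidHom.range_eq_map]

theorem antitone_of_inner_nonneg {x : TypeASpace n}
    (hx : ∀ i, 0 ≤ inner ℝ x (typeASimpleRoots n i)) : Antitone x.1 := by
  rcases n with _ | n
  · exact fun i => i.elim0
  · rw [Fin.antitone_iff_succ_le]
    intro i
    have := hx i
    rw [inner_typeASimpleRoots] at this
    exact sub_nonneg.1 this

theorem strictAnti_of_inner_pos {x : TypeASpace n}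
    (hx : ∀ i, 0 < inner ℝ x (typeASimpleRoots n i)) : StrictAnti x.1 := by
  rcases n with _ | n
  · exact fun i => i.elim0
  · rw [Fin.strictAnti_iff_succ_lt]
    intro i
    have := hx i
    rw [inner_typeASimpleRoots] at this
    exact sub_pos.1 this

theorem antitone_comp_perm_eq {f : Fin n → ℝ} (hf : Antitone f) {τ : Equiv.Perm (Fin n)}
    (hτ : Antitone (f ∘ τ)) : f ∘ τ = f := by
  have h1 : Monotone ((-f) ∘ τ) := hτ.neg
  have h2 : Monotone ((-f) ∘ (1 : Equiv.Perm (Fin n))) := hf.neg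
  rw [← Tuple.comp_sort_eq_comp_iff_monotone] at h1 h2
  have h3 := h1.trans h2.symm
  funext i
  have := congrFun h3 i
  simpa using this

theorem hasChamber_typeA : HasChamber (typeASimpleRoots n) (weylGroup (typeARoots n)) where
  finite := by
    rw [weylGroup_typeA, MonoidHom.coe_range]
    exact Set.finite_range _
  exists_dominant y := by
    rw [weylGroup_typeA]
    -- Dominant means decreasing coordinates, while `Tuple.sort` sorts increasingly; hence the sign.
    refine ⟨_, ⟨(Tuple.sort (-y.1 : Fin n → ℝ)).symm, rfl⟩, fun i => ?_⟩
    rw [inner_typeASimpleRoots, permHom_apply, permHom_apply, sub_nonneg]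
    have := Tuple.monotone_sort (-y.1 : Fin n → ℝ)
      (show (⟨i, by omega⟩ : Fin n) ≤ ⟨i + 1, by omega⟩ from Nat.le_succ i)
    simpa using this
  inner_lt v u hv hu σ hσ hne := by
    rw [weylGroup_typeA] at hσ
    obtain ⟨τ, rfl⟩ := hσ
    have hv' := strictAnti_of_inner_pos hv
    have hu' := antitone_of_inner_nonneg hu
    rw [typeA_inner, typeA_inner]
    simp only [permHom_apply]
    -- Equality in the rearrangement inequality would force the permuted `u` to be decreasing along
    -- the strictly decreasing `v`, hence to equal `u`.
    rw [Monovary.sum_mul_comp_perm_lt_sum_mul_iff (hv'.antitone.monovary hu')]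
    intro hmono
    refine hne (typeA_ext fun i => ?_)
    rw [permHom_apply]
    refine congrFun (antitone_comp_perm_eq hu' (τ := τ.symm) fun i j hij => ?_) i
    by_contra! hlt
    exact absurd (hv'.le_iff_ge.1 (hmono hlt)) (not_le.2 (hij.lt_of_ne fun h => by
      rw [h] at hlt; exact hlt.false))

/-- The coordinates decrease, with a strict drop from `i` to `i + 1` exactly when `i ∈ D`. The
criterion matches `index_eq_iff`, so the level sets are the blocks. -/
theorem facetNormal_apply_eq_iff {D : Finset (Fin (n - 1))} {p q : Fin n} (hpq : p < q) :
    (facetNormal (typeASimpleRoots n) (delta (typeARoots n) (typeASimpleRoots n)) D).1 p =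
      (facetNormal (typeASimpleRoots n) (delta (typeARoots n) (typeASimpleRoots n)) D).1 q ↔
    ∀ i ∈ D, ¬ ((p : ℕ) ≤ i ∧ (i : ℕ) < q) := by
  set u := facetNormal (typeASimpleRoots n) (delta (typeARoots n) (typeASimpleRoots n)) D with hu
  have hanti : Antitone u.1 := antitone_of_inner_nonneg (inner_facetNormal_nonneg isObtuse_typeA D)
  constructor
  · rintro h i hi ⟨h1, h2⟩
    have h3 := inner_facetNormal_pos isObtuse_typeA hi
    rw [inner_typeASimpleRoots, ← hu] at h3
    have h4 := hanti (show p ≤ ⟨i, by omega⟩ from h1)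
    have h5 := hanti (show (⟨i + 1, by omega⟩ : Fin n) ≤ q from h2)
    linarith
  · intro h
    obtain ⟨q, hq⟩ := q
    induction q with
    | zero => exact absurd hpq (Nat.not_lt_zero _)
    | succ m ih =>
      have h1 : u.1 ⟨m, by omega⟩ = u.1 ⟨m + 1, hq⟩ := by
        have h2 := inner_facetNormal_eq_zero isObtuse_typeA (D := D) (i := ⟨m, by omega⟩)
          fun hm => h _ hm ⟨Nat.lt_succ_iff.1 hpq, Nat.lt_succ_self m⟩
        rw [inner_typeASimpleRoots, ← hu] at h2
        exact sub_eq_zero.1 h2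
      rw [← h1]
      rcases (Nat.lt_succ_iff.1 hpq).lt_or_eq with hlt | heq
      · exact ih (by omega) hlt fun i hi hpi => h i hi ⟨hpi.1, Nat.lt_succ_of_lt hpi.2⟩
      · exact congrArg _ (Fin.ext heq)

theorem ncard_orbit_facetNormal_mul (c : Composition n) :
    ((fun σ : TypeASpace n ≃ₗᵢ[ℝ] TypeASpace n => σ (facetNormal (typeASimpleRoots n)
      (delta (typeARoots n) (typeASimpleRoots n)) (bars n c))) ''
        weylGroup (typeARoots n)).ncard * (c.blocks.map Nat.factorial).prod = n.factorial := by
  set u := facetNormal (typeASimpleRoots n) (delta (typeARoots n) (typeASimpleRoots n)) (bars n c)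
    with hu
  have hker : ∀ p q, u.1 p = u.1 q ↔ c.index p = c.index q := by
    intro p q
    rcases lt_trichotomy p q with h | rfl | h
    · rw [facetNormal_apply_eq_iff h, index_eq_iff h]
    · simp
    · rw [eq_comm, facetNormal_apply_eq_iff h, eq_comm, index_eq_iff h]
  -- Inverses turn the action into the composition `u ∘ τ`, which can be compared with `c.index ∘
  -- τ`.
  have himg : (fun σ : TypeASpace n ≃ₗᵢ[ℝ] TypeASpace n => σ u) '' weylGroup (typeARoots n) =
      (fun τ : Equiv.Perm (Fin n) => permHom n τ⁻¹ u) '' Set.univ := by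
    rw [weylGroup_typeA]
    ext x
    constructor
    · rintro ⟨_, ⟨τ, rfl⟩, rfl⟩
      exact ⟨τ⁻¹, trivial, by simp⟩
    · rintro ⟨τ, -, rfl⟩
      exact ⟨_, ⟨τ⁻¹, rfl⟩, rfl⟩
  rw [himg, ncard_image_eq_ncard_image (g := fun τ : Equiv.Perm (Fin n) => c.index ∘ τ),
    Set.image_univ, ← card_stabilizer_index, ncard_range_comp_perm_mul, Fintype.card_fin]
  intro σ _ τ _
  have h1 : ∀ i, (permHom n σ⁻¹ u).1 i = (permHom n τ⁻¹ u).1 i ↔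
      c.index (σ i) = c.index (τ i) := fun i => by
    rw [permHom_apply, permHom_apply]
    exact hker _ _
  constructor
  · intro h
    funext i
    exact (h1 i).1 (by rw [h])
  · intro h
    exact typeA_ext fun i => (h1 i).2 (congrFun h i)

end TypeAGeometry

end

end Permutonestohedron


theorem mainTheorem10 (n k : ℕ) (hk : k + 2 ≤ n) (ε : ℕ → ℝ)
    (hε : Permutonestohedron.IsSuitableList
      (Permutonestohedron.typeARoots n) (Permutonestohedron.typeASimpleRoots n)
      (Permutonestohedron.maximalBuildingSet (Permutonestohedron.typeARoots n)) ε) :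
    ((Permutonestohedron.facesOfCodim
        (Permutonestohedron.permutonestohedron
          (Permutonestohedron.typeARoots n) (Permutonestohedron.typeASimpleRoots n)
          (Permutonestohedron.maximalBuildingSet (Permutonestohedron.typeARoots n)) ε)
        (k + 1)).ncard : ℚ) =
      ∑ p : n.Partition with k + 2 ≤ p.parts.card,
        Permutonestohedron.partitionWeight p * Permutonestohedron.partitionMultinomial p *
          (Permutonestohedron.chainSum k p.parts.card : ℚ) := by
  have hne : Nonempty (Fin (n - 1)) := ⟨⟨0, by omega⟩⟩
  rw [Permutonestohedron.permutonestohedron_maximal_eq Permutonestohedron.typeASimpleRoots_mem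
      Permutonestohedron.zero_notMem_typeARoots ε,
    Permutonestohedron.ncard_facesOfCodim_eq_sum Permutonestohedron.hasChamber_typeA
      Permutonestohedron.isObtuse_typeA ε
      (hε.isGapped Permutonestohedron.typeASimpleRoots_mem
        Permutonestohedron.zero_notMem_typeARoots Permutonestohedron.isObtuse_typeA) k]
  simp only [Permutonestohedron.card_flagsWithTop]
  exact Permutonestohedron.sum_eq_sum_partition (by omega) k _
    Permutonestohedron.ncard_orbit_facetNormal_mul
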